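/- All graphs are finite and undirected, and $c(X)$ denotes the number of connected components of a graph $X$. For a finite group $G$ let: - $P_0(G)$ be the proper power graph: its vertices are the elements $x\neq 1$ of $G$, and distinct $x,y$ are adjacent iff one of them is a power of the other; put $c_0(G)=c(P_0(G))$; - $\widetilde P_0(G)$ be the proper quotient power graph: the power graph of $G$ (defined in the same way on all of $G$) is divided by the equivalence relation $x\sim y\iff\langle x\rangle=\langle y\rangle$ (distinct classes being adjacent iff they have adjacent representatives), and the class of $1$ is deleted; put $\widetilde c_0(G)=c(\widetilde P_0(G))$; - $\mathcal O_0(G)$ be the proper order graph: its vertices are the orders $\neq 1$ of elements of $G$, and distinct $k,l$ are adjacent iff $k\mid l$ or $l\mid k$; put $c_0(\mathcal O(G))=c(\mathcal O_0(G))$. The type of a permutation in $S_n$ is the partition of $n$ formed by the lengths of its orbits on $\{1,\dots,n\}$ (fixed points included). For a partition $T$ of $n$ and a positive integer $a$, the power $T^a$ is the partition obtained by replacing each term $m$ of $T$ by $\gcd(a,m)$ terms equal to $m/\gcd(a,m)$. For $G\le S_n$ let $P_0(\mathcal T(G))$ be the graph whose vertices are the types, other than $[1^n]$, of elements of $G$,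 distinct types being adjacent iff one of them is a power of the other; put $c_0(\mathcal T(G))=c(P_0(\mathcal T(G)))$. **Theorem B.** For every $n\ge 2$ one has $c_0(S_n)=\widetilde c_0(S_n)$, and the values of $c_0(S_n)$, $c_0(\mathcal T(S_n))$ and $c_0(\mathcal O(S_n))$ are as follows. (i) For $2\le n\le 7$: $$\begin{array}{c|cccccc} n&2&3&4&5&6&7\\\hline c_0(S_n)&1&4&13&31&83&128\\ c_0(\mathcal T(S_n))&1&2&3&3&4&3\\ c_0(\mathcal O(S_n))&1&2&2&2&2&2\end{array}$$ (ii) For $n\ge 8$: if $n$ is prime, then $c_0(S_n)=(n-2)!+1$ and $c_0(\mathcal T(S_n))=c_0(\mathcal O(S_n))=2$; if $n-1$ is prime, then $c_0(S_n)=n\,(n-3)!+1$ and $c_0(\mathcal T(S_n))=c_0(\mathcal O(S_n))=2$; if neither $n$ nor $n-1$ is prime, then $c_0(S_n)=c_0(\mathcal T(S_n))=c_0(\mathcal O(S_n))=1$. -/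

import Mathlib

/-! Graphs on a type of vertices are `SimpleGraph`s: the loops which a reflexive graph carries at
every vertex have no influence on its connected components. -/

namespace PowerGraph

section Graphs

variable {V : Type*}

/-- The `v`-deleted subgraph: all vertices except `v`, all edges not incident to `v`. -/
abbrev deleteVertex (X : SimpleGraph V) (v : V) : SimpleGraph ({v}ᶜ : Set V) :=
  X.induce ({v}ᶜ : Set V)

/-- The quotient graph `X / ∼`: two distinct classes are adjacent when they have
adjacent representatives. -/
def quotientGraph (X : SimpleGraph V) (s : Setoid V) : SimpleGraph (Quotient s) :=
  SimpleGraph.fromRel fun p q =>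
    ∃ x y : V, Quotient.mk s x = p ∧ Quotient.mk s y = q ∧ X.Adj x y

/-- The number of connected components of a graph. -/
noncomputable def numComponents (X : SimpleGraph V) : ℕ :=
  Nat.card X.ConnectedComponent

end Graphs

section Groups

variable (G : Type*) [Group G]

/-- The power graph `P(G)`: two distinct elements are adjacent when one of them is a power of
the other, with a positive exponent. -/
def powerGraph : SimpleGraph G :=
  SimpleGraph.fromRel fun x y => ∃ m : ℕ, 0 < m ∧ x = y ^ m

/-- The proper power graph `P₀(G)`. -/
abbrev properPowerGraph : SimpleGraph ({1}ᶜ : Set G) :=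
  deleteVertex (powerGraph G) 1

/-- `c₀(G)`, the number of components of `P₀(G)`. -/
noncomputable def c₀ : ℕ :=
  numComponents (properPowerGraph G)

/-- `x ∼ y` when `x` and `y` generate the same cyclic subgroup. -/
def sameCyclic : Setoid G where
  r x y := Subgroup.zpowers x = Subgroup.zpowers y
  iseqv := ⟨fun _ => rfl, fun h => h.symm, fun h h' => h.trans h'⟩

/-- The quotient power graph of `G`. -/
def quotientPowerGraph : SimpleGraph (Quotient (sameCyclic G)) :=
  quotientGraph (powerGraph G) (sameCyclic G)

/-- The proper quotient power graph of `G`: the class of `1` is deleted. -/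
abbrev properQuotientPowerGraph :
    SimpleGraph ({Quotient.mk (sameCyclic G) 1}ᶜ : Set (Quotient (sameCyclic G))) :=
  deleteVertex (quotientPowerGraph G) (Quotient.mk (sameCyclic G) 1)

/-- The number of components of the proper quotient power graph of `G`. -/
noncomputable def cTilde₀ : ℕ :=
  numComponents (properQuotientPowerGraph G)

/-- `O(G)`, the set of the orders of the elements of `G`. -/
abbrev orders : Set ℕ :=
  Set.range fun g : G => orderOf g

/-- `1 ∈ O(G)`. -/
def oneOrder : orders G :=
  ⟨1, 1, orderOf_one⟩

/-- The order graph: two distinct element orders are adjacent when one divides the other. -/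
def orderGraph : SimpleGraph (orders G) :=
  SimpleGraph.fromRel fun k l => (k : ℕ) ∣ (l : ℕ)

/-- The proper order graph: the order `1` is deleted. -/
abbrev properOrderGraph : SimpleGraph ({oneOrder G}ᶜ : Set (orders G)) :=
  deleteVertex (orderGraph G) (oneOrder G)

/-- The number of components of the proper order graph of `G`. -/
noncomputable def cOrder₀ : ℕ :=
  numComponents (properOrderGraph G)

end Groups

section Partitions

theorem sum_parts_pow (a : ℕ) (s : Multiset ℕ) :
    (s.bind fun m => Multiset.replicate (Nat.gcd a m) (m / Nat.gcd a m)).sum = s.sum := by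
  induction s using Multiset.induction_on with
  | empty => simp
  | cons m s ih =>
    simp [Multiset.cons_bind, ih, Nat.mul_div_cancel' (Nat.gcd_dvd_right a m)]

/-- The power `T ^ a` of a partition `T`: each term `m` is replaced by `gcd (a, m)` copies of
`m / gcd (a, m)`. -/
def partitionPow {n : ℕ} (T : n.Partition) (a : ℕ) : n.Partition where
  parts := T.parts.bind fun m => Multiset.replicate (Nat.gcd a m) (m / Nat.gcd a m)
  parts_pos := by
    intro i hi
    obtain ⟨m, hm, hi⟩ := Multiset.mem_bind.1 hi
    rw [Multiset.eq_of_mem_replicate hi]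
    exact Nat.div_pos (Nat.gcd_le_right a (T.parts_pos hm))
      (Nat.gcd_pos_of_pos_right a (T.parts_pos hm))
  parts_sum := by rw [sum_parts_pow, T.parts_sum]

end Partitions

section Permutations

variable {α : Type*} [Fintype α] [DecidableEq α] (G : Subgroup (Equiv.Perm α))

/-- `𝒯(G)`, the set of the types of the permutations in `G`. The type of a permutation is
the partition of the degree given by the lengths of its orbits, fixed points included. -/
abbrev types : Set (Fintype.card α).Partition :=
  {T | ∃ σ ∈ G, σ.partition = T}

/-- The trivial type `[1, …, 1]`, as the type of the identity. -/
def trivialType : types G :=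
  ⟨(1 : Equiv.Perm α).partition, 1, G.one_mem, rfl⟩

/-- The power type graph: two distinct types are adjacent when one of them is a power of
the other, as partitions. -/
def typeGraph : SimpleGraph (types G) :=
  SimpleGraph.fromRel fun S T =>
    ∃ a : ℕ, 0 < a ∧
      (S : (Fintype.card α).Partition) = partitionPow (T : (Fintype.card α).Partition) a

/-- The proper power type graph: the trivial type is deleted. -/
abbrev properTypeGraph : SimpleGraph ({trivialType G}ᶜ : Set (types G)) :=
  deleteVertex (typeGraph G) (trivialType G)

/-- The number of components of the proper power type graph of the permutation group `G`. -/
noncomputable def cType₀ : ℕ :=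
  numComponents (properTypeGraph G)

end Permutations

/-- The symmetric group of degree `n`. -/
abbrev Sym (n : ℕ) : Type :=
  Equiv.Perm (Fin n)

end PowerGraph

/-! Every element other than the identity has a power of prime order, so components can be counted
on elements of prime order alone. Two such elements are linked if they generate the same subgroup,
or if they commute and have different orders, since both are then powers of their product.
Conversely, a function unchanged by these two moves is constant on components. The four graphs are
images of the proper power graph under vertex maps compatible with orders and powers, so the single
count `IsPowerQuotient.numComponents_eq` serves them all.

In the symmetric group of degree `n`, at most one of `n` and `n - 1` is an odd prime `p`. An element
of order `p` is a `p`-cycle and commutes with no element of another prime order, so each subgroup of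
order `p` gives a component of its own: `n! / (p * (p - 1))` of them in the power graph, a single
one for types and for orders. Any other element of odd prime order commutes with an involution
(`exists_orderOf_two_commute`), so only the involutions remain to be sorted.

From degree `8` on, elements of order `3` link every involution to a transposition and all
transpositions to each other (`powerConnected_of_eight_le_card`). In smaller degrees there is too
little room; counting the orbits of two commuting permutations (`exists_card_orbits_of_commute`)
shows which involutions stay apart. -/

namespace PowerGraph

/-! ### Components of images of a power graph, counted on elements of prime order. -/

section Counting

variable {G : Type*} [Group G] {W : Type*}

/-- `X` is the image of the proper power graph of `G` under the vertex map `π`, and `π` respects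
orders and powers. -/
structure IsPowerQuotient (X : SimpleGraph W) (π : ({1}ᶜ : Set G) → W) : Prop where
  surjective : Function.Surjective π
  eq_or_adj_of_pow : ∀ (x : ({1}ᶜ : Set G)) (m : ℕ) (hm : (x : G) ^ m ∈ ({1}ᶜ : Set G)),
    π ⟨(x : G) ^ m, hm⟩ = π x ∨ X.Adj (π ⟨(x : G) ^ m, hm⟩) (π x)
  exists_pow_of_adj : ∀ {v w : W}, X.Adj v w →
    ∃ (x : ({1}ᶜ : Set G)) (m : ℕ) (hm : (x : G) ^ m ∈ ({1}ᶜ : Set G)),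
      (π ⟨(x : G) ^ m, hm⟩ = v ∧ π x = w) ∨ (π ⟨(x : G) ^ m, hm⟩ = w ∧ π x = v)
  orderOf_eq : ∀ {x y : ({1}ᶜ : Set G)}, π x = π y → orderOf (x : G) = orderOf (y : G)
  pow_eq : ∀ {x y : ({1}ᶜ : Set G)}, π x = π y → ∀ (m : ℕ)
    (hx : (x : G) ^ m ∈ ({1}ᶜ : Set G)) (hy : (y : G) ^ m ∈ ({1}ᶜ : Set G)),
    π ⟨(x : G) ^ m, hx⟩ = π ⟨(y : G) ^ m, hy⟩

theorem ne_one_of_prime_orderOf {x : G} (hx : (orderOf x).Prime) : x ∈ ({1}ᶜ : Set G) := by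
  rintro rfl
  simp [Nat.not_prime_one] at hx

/-- The power of `x` of prime order for the least prime divisor of the order of `x`. -/
noncomputable def primePart (x : G) : G :=
  x ^ (orderOf x / (orderOf x).minFac)

theorem orderOf_primePart [Finite G] (x : G) :
    orderOf (primePart x) = (orderOf x).minFac := by
  have h0 : orderOf x ≠ 0 := (orderOf_pos x).ne'
  have hd := Nat.minFac_dvd (orderOf x)
  rw [primePart, orderOf_pow_of_dvd _ (Nat.div_dvd_of_dvd hd), Nat.div_div_self hd h0]
  exact (Nat.div_pos (Nat.minFac_le (orderOf_pos x)) (Nat.minFac_pos _)).ne'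

theorem prime_orderOf_primePart [Finite G] {x : G} (hx : x ≠ 1) :
    (orderOf (primePart x)).Prime := by
  rw [orderOf_primePart]
  exact Nat.minFac_prime fun h => hx (orderOf_eq_one_iff.1 h)

theorem primePart_of_prime {x : G} (hx : (orderOf x).Prime) : primePart x = x := by
  rw [primePart, hx.minFac_eq, Nat.div_self hx.pos, pow_one]

theorem zpowers_pow_eq_zpowers_pow_gcd (x : G) (k : ℕ) :
    Subgroup.zpowers (x ^ k) = Subgroup.zpowers (x ^ (orderOf x).gcd k) := by
  apply le_antisymm
  · rw [Subgroup.zpowers_le]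
    obtain ⟨c, hc⟩ := Nat.gcd_dvd_right (orderOf x) k
    have e : x ^ k = (x ^ (orderOf x).gcd k) ^ c := by rw [← pow_mul, ← hc]
    rw [e]
    exact pow_mem (Subgroup.mem_zpowers _) c
  · rw [Subgroup.zpowers_le, ← zpow_natCast x (Nat.gcd _ _), Nat.gcd_eq_gcd_ab, zpow_add,
      zpow_mul, zpow_natCast,
      pow_orderOf_eq_one, one_zpow, one_mul, zpow_mul, zpow_natCast]
    exact zpow_mem (Subgroup.mem_zpowers _) _

/-- A finite cyclic group has one subgroup of each order: `x ^ k` generates the same subgroup as `x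
^ (orderOf x).gcd k`, and this gcd is recovered from the order of `x ^ k`. -/
theorem zpowers_eq_of_mem_zpowers [Finite G] {x u v : G} (hu : u ∈ Subgroup.zpowers x)
    (hv : v ∈ Subgroup.zpowers x) (h : orderOf u = orderOf v) :
    Subgroup.zpowers u = Subgroup.zpowers v := by
  rw [← mem_powers_iff_mem_zpowers] at hu hv
  obtain ⟨k, rfl⟩ := hu
  obtain ⟨l, rfl⟩ := hv
  dsimp only at h ⊢
  rw [orderOf_pow, orderOf_pow] at h
  rw [zpowers_pow_eq_zpowers_pow_gcd x k, zpowers_pow_eq_zpowers_pow_gcd x l]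
  have h0 := (orderOf_pos x).ne'
  have hk := Nat.gcd_dvd_left (orderOf x) k
  have hl := Nat.gcd_dvd_left (orderOf x) l
  rw [← Nat.div_div_self hk h0, h, Nat.div_div_self hl h0]

theorem zpowers_pow_eq {x y : G} (h : Subgroup.zpowers x = Subgroup.zpowers y) (m : ℕ) :
    Subgroup.zpowers (x ^ m) = Subgroup.zpowers (y ^ m) := by
  have key : ∀ {x y : G}, Subgroup.zpowers x = Subgroup.zpowers y →
      Subgroup.zpowers (x ^ m) ≤ Subgroup.zpowers (y ^ m) := by
    intro x y h
    obtain ⟨k, hk⟩ := Subgroup.mem_zpowers_iff.1 (h ▸ Subgroup.mem_zpowers x)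
    rw [Subgroup.zpowers_le, ← hk]
    refine Subgroup.mem_zpowers_iff.2 ⟨k, ?_⟩
    rw [← zpow_natCast, ← zpow_natCast, zpow_comm]
  exact le_antisymm (key h) (key h.symm)

theorem properPowerGraph_adj {x y : ({1}ᶜ : Set G)} : (properPowerGraph G).Adj x y ↔
    (x : G) ≠ y ∧ ((∃ m : ℕ, 0 < m ∧ (x : G) = (y : G) ^ m) ∨
      ∃ m : ℕ, 0 < m ∧ (y : G) = (x : G) ^ m) :=
  Iff.rfl

namespace IsPowerQuotient

variable {X : SimpleGraph W} {π : ({1}ᶜ : Set G) → W}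

theorem reachable_of_pow (h : IsPowerQuotient X π) {x y : ({1}ᶜ : Set G)} {m : ℕ}
    (hm : (y : G) = (x : G) ^ m) : X.Reachable (π y) (π x) := by
  obtain ⟨y, hy⟩ := y
  obtain rfl : y = (x : G) ^ m := hm
  rcases h.eq_or_adj_of_pow x m hy with e | e
  · rw [e]
  · exact e.reachable

theorem reachable_of_reachable (h : IsPowerQuotient X π) {x y : ({1}ᶜ : Set G)}
    (hxy : (properPowerGraph G).Reachable x y) : X.Reachable (π x) (π y) := by
  obtain ⟨p⟩ := hxy
  induction p with
  | nil => exact SimpleGraph.Reachable.refl _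
  | cons e _ ih =>
    obtain ⟨-, ⟨m, -, hm⟩ | ⟨m, -, hm⟩⟩ := properPowerGraph_adj.1 e
    · exact (h.reachable_of_pow hm).trans ih
    · exact (h.reachable_of_pow hm).symm.trans ih

theorem reachable_of_zpowers_eq [Finite G] (h : IsPowerQuotient X π) {x y : ({1}ᶜ : Set G)}
    (hxy : Subgroup.zpowers (x : G) = Subgroup.zpowers (y : G)) : X.Reachable (π x) (π y) := by
  have : (x : G) ∈ Subgroup.zpowers (y : G) := hxy ▸ Subgroup.mem_zpowers _
  rw [← mem_powers_iff_mem_zpowers] at this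
  obtain ⟨m, hm⟩ := this
  exact h.reachable_of_pow hm.symm

/-- By the Chinese remainder theorem some exponent is `1` modulo one order and `0` modulo the other,
so `x` and `y` are both powers of `x * y`. -/
theorem reachable_of_commute (h : IsPowerQuotient X π) {x y : ({1}ᶜ : Set G)}
    (hx : (orderOf (x : G)).Prime) (hy : (orderOf (y : G)).Prime)
    (hne : orderOf (x : G) ≠ orderOf (y : G)) (hxy : Commute (x : G) y) :
    X.Reachable (π x) (π y) := by
  have hcop : (orderOf (x : G)).Coprime (orderOf (y : G)) := (Nat.coprime_primes hx hy).2 hne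
  have key : ∀ u v : G, Commute u v → (orderOf u).Coprime (orderOf v) →
      ∃ m : ℕ, u = (u * v) ^ m := by
    intro u v huv hc
    obtain ⟨k, hk⟩ := Nat.chineseRemainder hc 1 0
    refine ⟨k, ?_⟩
    rw [huv.mul_pow, pow_eq_pow_iff_modEq.2 hk.1, pow_eq_pow_iff_modEq.2 hk.2, pow_one, pow_zero,
      mul_one]
  have hz : (x : G) * y ∈ ({1}ᶜ : Set G) := by
    intro hz
    obtain ⟨m, hm⟩ := key x y hxy hcop
    rw [Set.mem_singleton_iff.1 hz, one_pow] at hm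
    exact x.2 hm
  obtain ⟨m, hm⟩ := key x y hxy hcop
  obtain ⟨k, hk⟩ := key y x hxy.symm hcop.symm
  rw [← hxy.eq] at hk
  exact (h.reachable_of_pow (x := ⟨_, hz⟩) hm).trans (h.reachable_of_pow (x := ⟨_, hz⟩) hk).symm

theorem reachable_primePart [Finite G] (h : IsPowerQuotient X π) (x : ({1}ᶜ : Set G)) :
    X.Reachable (π ⟨primePart (x : G), ne_one_of_prime_orderOf (prime_orderOf_primePart x.2)⟩)
      (π x) :=
  h.reachable_of_pow (m := orderOf (x : G) / (orderOf (x : G)).minFac) rfl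

/-- The components of a quotient of the power graph are counted by a complete invariant of the
elements of prime order. -/
theorem numComponents_eq [Finite G] (h : IsPowerQuotient X π) {ι : Type*} (f : G → ι)
    (hz : ∀ x y : G, (orderOf x).Prime → (orderOf y).Prime →
      Subgroup.zpowers x = Subgroup.zpowers y → f x = f y)
    (hc : ∀ x y : G, (orderOf x).Prime → (orderOf y).Prime → orderOf x ≠ orderOf y →
      Commute x y → f x = f y)
    (hπ : ∀ x y : ({1}ᶜ : Set G), (orderOf (x : G)).Prime → π x = π y → f x = f y)
    (hr : ∀ x y : ({1}ᶜ : Set G), (orderOf (x : G)).Prime → (orderOf (y : G)).Prime →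
      f x = f y → X.Reachable (π x) (π y)) :
    numComponents X = (f '' {x : G | (orderOf x).Prime}).ncard := by
  -- Inside a cyclic group, elements of prime order either generate the same subgroup or commute and
  -- have different orders, so `hz` and `hc` cover all cases.
  have hcyc : ∀ x u v : G, u ∈ Subgroup.zpowers x → v ∈ Subgroup.zpowers x →
      (orderOf u).Prime → (orderOf v).Prime → f u = f v := by
    intro x u v hu hv hu' hv'
    by_cases e : orderOf u = orderOf v
    · exact hz u v hu' hv' (zpowers_eq_of_mem_zpowers hu hv e)
    · refine hc u v hu' hv' e ?_
      obtain ⟨k, rfl⟩ := Subgroup.mem_zpowers_iff.1 hu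
      obtain ⟨l, rfl⟩ := Subgroup.mem_zpowers_iff.1 hv
      exact (Commute.refl x).zpow_zpow k l
  have hpow : ∀ (x : G) (m : ℕ), x ≠ 1 → x ^ m ≠ 1 → f (primePart (x ^ m)) = f (primePart x) := by
    intro x m hx hm
    refine hcyc x _ _ ?_ ?_ (prime_orderOf_primePart hm) (prime_orderOf_primePart hx)
    · exact pow_mem (pow_mem (Subgroup.mem_zpowers x) m) _
    · exact pow_mem (Subgroup.mem_zpowers x) _
  have hfib : ∀ x y : ({1}ᶜ : Set G), π x = π y → f (primePart (x : G)) = f (primePart (y : G)) := by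
    intro x y hxy
    have hx := ne_one_of_prime_orderOf (prime_orderOf_primePart x.2)
    have hy := ne_one_of_prime_orderOf (prime_orderOf_primePart y.2)
    refine hπ ⟨_, hx⟩ ⟨_, hy⟩ (prime_orderOf_primePart x.2) ?_
    -- Elements of one fibre have equal orders, so both prime parts are taken with the same
    -- exponent.
    simp only [primePart, h.orderOf_eq hxy] at hx hy ⊢
    exact h.pow_eq hxy _ hx hy
  choose s hs using h.surjective
  let F : W → ι := fun w => f (primePart (s w : G))
  have hF : ∀ x, F (π x) = f (primePart (x : G)) := fun x => hfib _ _ (hs _)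
  have hadj : ∀ v w, X.Adj v w → F v = F w := by
    intro v w hvw
    obtain ⟨x, m, hm, ⟨rfl, rfl⟩ | ⟨rfl, rfl⟩⟩ := h.exists_pow_of_adj hvw
    · rw [hF, hF]; exact hpow _ _ x.2 hm
    · rw [hF, hF]; exact (hpow _ _ x.2 hm).symm
  have hreach : ∀ v w, X.Reachable v w → F v = F w := by
    rintro v w ⟨p⟩
    induction p with
    | nil => rfl
    | cons e _ ih => exact (hadj _ _ e).trans ih
  let Φ : X.ConnectedComponent → ι :=
    SimpleGraph.ConnectedComponent.lift F fun v w p _ => hreach v w ⟨p⟩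
  have hinj : Function.Injective Φ := by
    intro c d
    refine SimpleGraph.ConnectedComponent.ind₂ (fun v w hvw => ?_) c d
    change F v = F w at hvw
    refine SimpleGraph.ConnectedComponent.sound ?_
    rw [← hs v, ← hs w]
    exact ((h.reachable_primePart (s v)).symm.trans (hr _ _ (prime_orderOf_primePart (s v).2)
      (prime_orderOf_primePart (s w).2) hvw)).trans (h.reachable_primePart (s w))
  have hrange : Set.range Φ = f '' {x : G | (orderOf x).Prime} := by
    ext i
    constructor
    · rintro ⟨c, rfl⟩
      refine SimpleGraph.ConnectedComponent.ind (fun v => ?_) c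
      exact ⟨_, prime_orderOf_primePart (s v).2, rfl⟩
    · rintro ⟨x, hx, rfl⟩
      refine ⟨X.connectedComponentMk (π ⟨x, ne_one_of_prime_orderOf hx⟩), ?_⟩
      change F _ = _
      rw [hF, primePart_of_prime hx]
  rw [numComponents, ← hrange, ← Set.image_univ, Set.ncard_image_of_injective _ hinj,
    Set.ncard_univ]

end IsPowerQuotient

end Counting

/-! ### The power graph, its quotient and the order graph. -/

section Instances

variable (G : Type*) [Group G]

/-- Edges ask for positive exponents; adding the order makes any exponent positive. -/
theorem exists_pos_pow_eq {G : Type*} [Group G] [Finite G] (x : G) (m : ℕ) :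
    ∃ k : ℕ, 0 < k ∧ x ^ k = x ^ m :=
  ⟨m + orderOf x, by have := orderOf_pos x; omega, by rw [pow_add, pow_orderOf_eq_one, mul_one]⟩

theorem isPowerQuotient_id [Finite G] : IsPowerQuotient (properPowerGraph G) id where
  surjective := Function.surjective_id
  eq_or_adj_of_pow x m hm := by
    by_cases e : (x : G) ^ m = x
    · exact Or.inl (Subtype.ext e)
    · obtain ⟨k, hk, hkm⟩ := exists_pos_pow_eq (x : G) m
      exact Or.inr (properPowerGraph_adj.2 ⟨e, Or.inl ⟨k, hk, hkm.symm⟩⟩)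
  exists_pow_of_adj {v w} hvw := by
    obtain ⟨-, ⟨m, -, hm⟩ | ⟨m, -, hm⟩⟩ := properPowerGraph_adj.1 hvw
    · exact ⟨w, m, hm ▸ v.2, Or.inl ⟨Subtype.ext hm.symm, rfl⟩⟩
    · exact ⟨v, m, hm ▸ w.2, Or.inr ⟨Subtype.ext hm.symm, rfl⟩⟩
  orderOf_eq e := congrArg (fun z : ({1}ᶜ : Set G) => orderOf (z : G)) e
  pow_eq {x y} e m _ _ := Subtype.ext (congrArg (fun z : ({1}ᶜ : Set G) => (z : G) ^ m) e)

theorem mk_ne_mk_one {x : G} (hx : x ∈ ({1}ᶜ : Set G)) :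
    Quotient.mk (sameCyclic G) x ∈
      ({Quotient.mk (sameCyclic G) 1}ᶜ : Set (Quotient (sameCyclic G))) := by
  intro e
  have e' : Subgroup.zpowers x = Subgroup.zpowers (1 : G) := Quotient.exact e
  rw [Subgroup.zpowers_one_eq_bot, Subgroup.zpowers_eq_bot] at e'
  exact hx e'

variable {G} in
theorem properQuotientPowerGraph_adj
    {v w : ({Quotient.mk (sameCyclic G) 1}ᶜ : Set (Quotient (sameCyclic G)))} :
    (properQuotientPowerGraph G).Adj v w ↔ v.1 ≠ w.1 ∧
      ((∃ x y : G, Quotient.mk _ x = v.1 ∧ Quotient.mk _ y = w.1 ∧ (powerGraph G).Adj x y) ∨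
        ∃ x y : G, Quotient.mk _ x = w.1 ∧ Quotient.mk _ y = v.1 ∧ (powerGraph G).Adj x y) :=
  Iff.rfl

theorem isPowerQuotient_mk [Finite G] : IsPowerQuotient (properQuotientPowerGraph G)
    fun x : ({1}ᶜ : Set G) => ⟨Quotient.mk (sameCyclic G) x, mk_ne_mk_one G x.2⟩ where
  surjective := by
    rintro ⟨q, hq⟩
    obtain ⟨x, rfl⟩ := Quotient.exists_rep q
    exact ⟨⟨x, fun e => hq (by rw [Set.mem_singleton_iff.1 e]; rfl)⟩, rfl⟩
  eq_or_adj_of_pow x m hm := by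
    by_cases e : Quotient.mk (sameCyclic G) ((x : G) ^ m) = Quotient.mk (sameCyclic G) (x : G)
    · exact Or.inl (Subtype.ext e)
    · obtain ⟨k, hk, hkm⟩ := exists_pos_pow_eq (x : G) m
      refine Or.inr (properQuotientPowerGraph_adj.2 ⟨e, Or.inl ⟨_, _, rfl, rfl, ?_⟩⟩)
      exact (SimpleGraph.fromRel_adj _ _ _).2 ⟨fun e' => e (congrArg _ e'), Or.inl ⟨k, hk, hkm.symm⟩⟩
  exists_pow_of_adj {v w} hvw := by
    have key : ∀ v w : ({Quotient.mk (sameCyclic G) 1}ᶜ : Set (Quotient (sameCyclic G))),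
        (∃ x y : G, Quotient.mk _ x = v.1 ∧ Quotient.mk _ y = w.1 ∧ (powerGraph G).Adj x y) →
        ∃ x y : ({1}ᶜ : Set G), Quotient.mk (sameCyclic G) (x : G) = v.1 ∧
          Quotient.mk (sameCyclic G) (y : G) = w.1 ∧
          ((∃ m : ℕ, (x : G) = (y : G) ^ m) ∨ ∃ m : ℕ, (y : G) = (x : G) ^ m) := by
      rintro v w ⟨x, y, hx, hy, hxy⟩
      refine ⟨⟨x, ?_⟩, ⟨y, ?_⟩, hx, hy, ?_⟩
      · rintro rfl; exact v.2 hx.symm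
      · rintro rfl; exact w.2 hy.symm
      · obtain ⟨-, ⟨m, -, hm⟩ | ⟨m, -, hm⟩⟩ := (SimpleGraph.fromRel_adj _ _ _).1 hxy
        exacts [Or.inl ⟨m, hm⟩, Or.inr ⟨m, hm⟩]
    have main : ∃ x y : ({1}ᶜ : Set G), Quotient.mk (sameCyclic G) (x : G) = v.1 ∧
          Quotient.mk (sameCyclic G) (y : G) = w.1 ∧
          ((∃ m : ℕ, (x : G) = (y : G) ^ m) ∨ ∃ m : ℕ, (y : G) = (x : G) ^ m) := by
      obtain ⟨-, e | e⟩ := properQuotientPowerGraph_adj.1 hvw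
      · exact key v w e
      · obtain ⟨x, y, hx, hy, hxy⟩ := key w v e
        exact ⟨y, x, hy, hx, hxy.symm⟩
    obtain ⟨⟨x, hx⟩, ⟨y, hy⟩, hv, hw, ⟨m, hm⟩ | ⟨m, hm⟩⟩ := main
    · dsimp only at hm; subst hm
      exact ⟨⟨y, hy⟩, m, hx, Or.inl ⟨Subtype.ext hv, Subtype.ext hw⟩⟩
    · dsimp only at hm; subst hm
      exact ⟨⟨x, hx⟩, m, hy, Or.inr ⟨Subtype.ext hw, Subtype.ext hv⟩⟩
  orderOf_eq {x y} e := by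
    have e' : Subgroup.zpowers (x : G) = Subgroup.zpowers (y : G) :=
      Quotient.exact (congrArg Subtype.val e)
    rw [← Nat.card_zpowers, e', Nat.card_zpowers]
  pow_eq {x y} e m _ _ := by
    have e' : Subgroup.zpowers (x : G) = Subgroup.zpowers (y : G) :=
      Quotient.exact (congrArg Subtype.val e)
    exact Subtype.ext (Quotient.sound (zpowers_pow_eq e' m))

/-- The quotient merges only generators of one cyclic subgroup, which are powers of each other. With
the component itself as invariant, both graphs are counted by the same set. -/
theorem c₀_eq_cTilde₀ [Finite G] : c₀ G = cTilde₀ G := by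
  have h := isPowerQuotient_id G
  have h' := isPowerQuotient_mk G
  -- The component of `x` as a set of vertices; the value at `1` is empty.
  let f : G → Set ({1}ᶜ : Set G) := fun x =>
    {v | ∃ hx : x ∈ ({1}ᶜ : Set G), (properPowerGraph G).Reachable ⟨x, hx⟩ v}
  have hf : ∀ x y : ({1}ᶜ : Set G), f x = f y ↔ (properPowerGraph G).Reachable x y := by
    intro x y
    constructor
    · intro e
      have : y ∈ f x := e ▸ ⟨y.2, SimpleGraph.Reachable.refl _⟩
      exact this.2
    · intro e
      ext v
      exact ⟨fun ⟨_, hv⟩ => ⟨y.2, e.symm.trans hv⟩, fun ⟨_, hv⟩ => ⟨x.2, e.trans hv⟩⟩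
  have hz : ∀ x y : G, (orderOf x).Prime → (orderOf y).Prime →
      Subgroup.zpowers x = Subgroup.zpowers y → f x = f y := fun x y hx hy e =>
    (hf ⟨x, ne_one_of_prime_orderOf hx⟩ ⟨y, ne_one_of_prime_orderOf hy⟩).2
      (h.reachable_of_zpowers_eq e)
  have hc : ∀ x y : G, (orderOf x).Prime → (orderOf y).Prime → orderOf x ≠ orderOf y →
      Commute x y → f x = f y := fun x y hx hy hne e =>
    (hf ⟨x, ne_one_of_prime_orderOf hx⟩ ⟨y, ne_one_of_prime_orderOf hy⟩).2
      (h.reachable_of_commute hx hy hne e)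
  rw [c₀, cTilde₀, h.numComponents_eq f hz hc
    (fun x y _ e => congrArg (fun z : ({1}ᶜ : Set G) => f (z : G)) e)
    fun x y _ _ e => (hf x y).1 e]
  refine (h'.numComponents_eq f hz hc (fun x y _ e => ?_) fun x y _ _ e => ?_).symm
  · exact (hf x y).2 (h.reachable_of_zpowers_eq (Quotient.exact (congrArg Subtype.val e)))
  · exact h'.reachable_of_reachable ((hf x y).1 e)

variable {G} in
theorem properOrderGraph_adj {v w : ({oneOrder G}ᶜ : Set (orders G))} :
    (properOrderGraph G).Adj v w ↔ v.1 ≠ w.1 ∧ ((v.1 : ℕ) ∣ (w.1 : ℕ) ∨ (w.1 : ℕ) ∣ (v.1 : ℕ)) :=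
  Iff.rfl

theorem isPowerQuotient_orderOf [Finite G] : IsPowerQuotient (properOrderGraph G)
    fun x : ({1}ᶜ : Set G) => ⟨⟨orderOf (x : G), x, rfl⟩, fun e =>
      x.2 (orderOf_eq_one_iff.1 (congrArg Subtype.val (Set.mem_singleton_iff.1 e)))⟩ where
  surjective := by
    rintro ⟨⟨k, x, rfl⟩, hk⟩
    refine ⟨⟨x, fun e => hk ?_⟩, rfl⟩
    rw [Set.mem_singleton_iff.1 e]
    exact Subtype.ext orderOf_one
  eq_or_adj_of_pow x m hm := by
    by_cases e : orderOf ((x : G) ^ m) = orderOf (x : G)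
    · exact Or.inl (Subtype.ext (Subtype.ext e))
    · refine Or.inr (properOrderGraph_adj.2 ⟨fun e' => e ?_, Or.inl ?_⟩)
      · exact congrArg Subtype.val e'
      · exact orderOf_pow_dvd m
  exists_pow_of_adj {v w} hvw := by
    have key : ∀ v w : ({oneOrder G}ᶜ : Set (orders G)), (v.1 : ℕ) ∣ (w.1 : ℕ) →
        ∃ (x : ({1}ᶜ : Set G)) (m : ℕ), (x : G) ^ m ∈ ({1}ᶜ : Set G) ∧
          orderOf ((x : G) ^ m) = v.1 ∧ orderOf (x : G) = w.1 := by
      rintro ⟨⟨k, hk⟩, hk1⟩ ⟨⟨l, x, rfl⟩, hl1⟩ hkl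
      change k ∣ orderOf x at hkl
      have hx : x ≠ 1 := by
        rintro rfl
        exact hl1 (Subtype.ext orderOf_one)
      have h0 := orderOf_pos x
      have hk0 : 0 < k := Nat.pos_of_dvd_of_pos hkl h0
      have ho : orderOf (x ^ (orderOf x / k)) = k := by
        rw [orderOf_pow_of_dvd (Nat.div_pos (Nat.le_of_dvd h0 hkl) hk0).ne'
          (Nat.div_dvd_of_dvd hkl), Nat.div_div_self hkl h0.ne']
      refine ⟨⟨x, hx⟩, orderOf x / k, fun e => hk1 (Subtype.ext ?_), ho, rfl⟩
      change k = 1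
      rw [← ho]
      exact orderOf_eq_one_iff.2 e
    obtain ⟨-, e | e⟩ := properOrderGraph_adj.1 hvw
    · obtain ⟨x, m, hm, hv, hw⟩ := key v w e
      exact ⟨x, m, hm, Or.inl ⟨Subtype.ext (Subtype.ext hv), Subtype.ext (Subtype.ext hw)⟩⟩
    · obtain ⟨x, m, hm, hv, hw⟩ := key w v e
      exact ⟨x, m, hm, Or.inr ⟨Subtype.ext (Subtype.ext hv), Subtype.ext (Subtype.ext hw)⟩⟩
  orderOf_eq e := congrArg (fun z => (z.1 : ℕ)) e
  pow_eq {x y} e m _ _ := by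
    have e' : orderOf (x : G) = orderOf (y : G) := congrArg (fun z => (z.1 : ℕ)) e
    refine Subtype.ext (Subtype.ext ?_)
    change orderOf ((x : G) ^ m) = orderOf ((y : G) ^ m)
    rw [orderOf_pow, orderOf_pow, e']

end Instances

/-! ### Powers of types as types of powers. -/

section Types

theorem sum_filter_dvd_eq (s : Multiset ℕ) {m : ℕ} (hm : m ≠ 0) :
    (s.filter (· ∣ m)).sum = ∑ d ∈ m.divisors, s.count d * d := by
  rw [Finset.sum_multiset_count_of_subset _ m.divisors]
  · refine Finset.sum_congr rfl fun d hd => ?_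
    rw [Multiset.count_filter_of_pos (p := (· ∣ m)) (Nat.dvd_of_mem_divisors hd), smul_eq_mul]
  · intro d hd
    exact Nat.mem_divisors.2 ⟨(Multiset.mem_filter.1 (Multiset.mem_toFinset.1 hd)).2, hm⟩

/-- The sums form a triangular system for divisibility: once the counts agree at the proper divisors
of `m`, the sum at `k = m` isolates the count of `m`. -/
theorem multiset_eq_of_sum_filter_dvd {s t : Multiset ℕ} (hs : 0 ∉ s) (ht : 0 ∉ t)
    (h : ∀ k, (s.filter (· ∣ k)).sum = (t.filter (· ∣ k)).sum) : s = t := by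
  ext m
  induction m using Nat.strong_induction_on with
  | _ m ih =>
    rcases Nat.eq_zero_or_pos m with rfl | hm
    · rw [Multiset.count_eq_zero.2 hs, Multiset.count_eq_zero.2 ht]
    · have e := h m
      rw [sum_filter_dvd_eq s hm.ne', sum_filter_dvd_eq t hm.ne',
        ← Nat.insert_self_properDivisors hm.ne',
        Finset.sum_insert Nat.self_notMem_properDivisors,
        Finset.sum_insert Nat.self_notMem_properDivisors,
        Finset.sum_congr rfl fun d hd => by rw [ih d (Nat.mem_properDivisors.1 hd).2]] at e
      exact Nat.eq_of_mul_eq_mul_right hm (Nat.add_right_cancel e)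

/-- For the type of a permutation, the sum of the parts not dividing `k` is the number of points
moved by the `k`-th power; this form makes types comparable through supports. -/
theorem partition_eq_of_sum_filter_not_dvd {n : ℕ} {S T : n.Partition}
    (h : ∀ k, (S.parts.filter (¬ · ∣ k)).sum = (T.parts.filter (¬ · ∣ k)).sum) : S = T := by
  refine Nat.Partition.ext (multiset_eq_of_sum_filter_dvd (fun h0 => (S.parts_pos h0).ne rfl)
    (fun h0 => (T.parts_pos h0).ne rfl) fun k => ?_)
  have hS := congrArg Multiset.sum (Multiset.filter_add_not (· ∣ k) S.parts)
  have hT := congrArg Multiset.sum (Multiset.filter_add_not (· ∣ k) T.parts)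
  rw [Multiset.sum_add, S.parts_sum] at hS
  rw [Multiset.sum_add, T.parts_sum] at hT
  have := h k
  omega

/-- The copies of `m / gcd a m` add up to `m`, and such a copy divides `k` exactly when `m ∣ a * k`.
-/
theorem sum_filter_bind_not_dvd (a k : ℕ) (s : Multiset ℕ) (hs : 0 ∉ s) :
    ((s.bind fun m => Multiset.replicate (Nat.gcd a m) (m / Nat.gcd a m)).filter
      (¬ · ∣ k)).sum = (s.filter (¬ · ∣ a * k)).sum := by
  induction s using Multiset.induction_on with
  | empty => simp
  | cons m s ih =>
    rw [Multiset.mem_cons, not_or] at hs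
    have hm : 0 < m := Nat.pos_of_ne_zero fun e => hs.1 e.symm
    have hg : 0 < Nat.gcd a m := Nat.gcd_pos_of_pos_right a hm
    have hiff : m / Nat.gcd a m ∣ k ↔ m ∣ a * k := by
      rw [Nat.div_dvd_iff_dvd_mul (Nat.gcd_dvd_right a m) hg]
      refine ⟨fun h => h.trans (Nat.mul_dvd_mul_right (Nat.gcd_dvd_left a m) k), fun h => ?_⟩
      rw [← Nat.gcd_mul_right]
      exact Nat.dvd_gcd h (Nat.dvd_mul_right m k)
    rw [Multiset.cons_bind, Multiset.filter_add, Multiset.sum_add, ih hs.2]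
    by_cases e : m ∣ a * k
    · rw [Multiset.filter_cons_of_neg (p := (¬ · ∣ a * k)) _ (not_not.2 e),
        Multiset.filter_eq_nil.2, Multiset.sum_zero,
        zero_add]
      intro j hj
      rw [Multiset.eq_of_mem_replicate hj]
      exact not_not.2 (hiff.2 e)
    · rw [Multiset.filter_cons_of_pos (p := (¬ · ∣ a * k)) _ e,
        Multiset.filter_eq_self.2, Multiset.sum_replicate,
        Multiset.sum_cons, smul_eq_mul, Nat.mul_div_cancel' (Nat.gcd_dvd_right a m)]
      intro j hj
      rw [Multiset.eq_of_mem_replicate hj]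
      exact fun h => e (hiff.1 h)

variable {α : Type*} [Fintype α] [DecidableEq α]

theorem card_support_pow (σ : Equiv.Perm α) (k : ℕ) :
    (σ ^ k).support.card = (σ.cycleType.filter (¬ · ∣ k)).sum := by
  induction σ using Equiv.Perm.cycle_induction_on with
  | base_one => simp
  | base_cycles σ hσ =>
    rw [hσ.cycleType, Multiset.filter_singleton]
    by_cases h : orderOf σ ∣ k
    · rw [orderOf_dvd_iff_pow_eq_one.1 h, if_neg (by rwa [not_not, ← hσ.orderOf])]
      simp
    · rw [hσ.support_pow_eq_iff.2 h, if_pos (by rwa [← hσ.orderOf]), Multiset.sum_singleton]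
  | induction_disjoint σ τ hd _ h1 h2 =>
    rw [hd.cycleType_mul, Multiset.filter_add, Multiset.sum_add, ← h1, ← h2, hd.commute.mul_pow]
    exact (hd.pow_disjoint_pow k k).card_support_mul

/-- For every `k`, both sides yield the number of points moved by `σ ^ (a * k)`. -/
theorem partition_pow (σ : Equiv.Perm α) (a : ℕ) :
    (σ ^ a).partition = partitionPow σ.partition a := by
  have key : ∀ (τ : Equiv.Perm α) (k : ℕ), (τ.partition.parts.filter (¬ · ∣ k)).sum =
      (τ ^ k).support.card := by
    intro τ k
    rw [Equiv.Perm.parts_partition, Multiset.filter_add, Multiset.sum_add, card_support_pow,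
      Nat.add_eq_left, Multiset.filter_eq_nil.2, Multiset.sum_zero]
    intro j hj
    rw [Multiset.eq_of_mem_replicate hj]
    exact not_not.2 (one_dvd k)
  refine partition_eq_of_sum_filter_not_dvd fun k => ?_
  rw [key, ← pow_mul, ← key]
  exact (sum_filter_bind_not_dvd a k _ fun h0 => (σ.partition.parts_pos h0).ne rfl).symm

theorem properTypeGraph_adj {H : Subgroup (Equiv.Perm α)}
    {v w : ({trivialType H}ᶜ : Set (types H))} :
    (properTypeGraph H).Adj v w ↔ v.1 ≠ w.1 ∧
      ((∃ a : ℕ, 0 < a ∧ (v.1 : (Fintype.card α).Partition) = partitionPow w.1.1 a) ∨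
        ∃ a : ℕ, 0 < a ∧ (w.1 : (Fintype.card α).Partition) = partitionPow v.1.1 a) :=
  Iff.rfl

theorem partition_eq_partition_one_iff {σ : Equiv.Perm α} :
    σ.partition = (1 : Equiv.Perm α).partition ↔ σ = 1 := by
  rw [← Equiv.Perm.partition_eq_of_isConj, isConj_comm, isConj_one_right]

theorem orderOf_eq_of_partition_eq {σ τ : Equiv.Perm α} (h : σ.partition = τ.partition) :
    orderOf σ = orderOf τ := by
  rw [← Equiv.Perm.partition_eq_of_isConj, Equiv.Perm.isConj_iff_cycleType_eq] at h
  rw [← Equiv.Perm.lcm_cycleType, h, Equiv.Perm.lcm_cycleType]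

variable (α) in
theorem isPowerQuotient_partition :
    IsPowerQuotient (properTypeGraph (⊤ : Subgroup (Equiv.Perm α)))
      fun x : ({1}ᶜ : Set (Equiv.Perm α)) =>
        ⟨⟨(x : Equiv.Perm α).partition, x, Subgroup.mem_top _, rfl⟩, fun e =>
          x.2 (partition_eq_partition_one_iff.1 (congrArg Subtype.val e))⟩ where
  surjective := by
    rintro ⟨⟨T, x, hx, rfl⟩, hT⟩
    refine ⟨⟨x, fun e => hT ?_⟩, rfl⟩
    exact Subtype.ext (partition_eq_partition_one_iff.2 e)
  eq_or_adj_of_pow x m hm := by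
    by_cases e : ((x : Equiv.Perm α) ^ m).partition = (x : Equiv.Perm α).partition
    · exact Or.inl (Subtype.ext (Subtype.ext e))
    · obtain ⟨k, hk, hkm⟩ := exists_pos_pow_eq (x : Equiv.Perm α) m
      refine Or.inr (properTypeGraph_adj.2 ⟨fun e' => e (congrArg Subtype.val e'),
        Or.inl ⟨k, hk, ?_⟩⟩)
      rw [← partition_pow, hkm]
  exists_pow_of_adj {v w} hvw := by
    have key : ∀ v w : ({trivialType (⊤ : Subgroup (Equiv.Perm α))}ᶜ : Set (types ⊤)),
        (∃ a : ℕ, 0 < a ∧ (v.1 : (Fintype.card α).Partition) = partitionPow w.1.1 a) →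
        ∃ (x : ({1}ᶜ : Set (Equiv.Perm α))) (m : ℕ),
          (x : Equiv.Perm α) ^ m ∈ ({1}ᶜ : Set (Equiv.Perm α)) ∧
          ((x : Equiv.Perm α) ^ m).partition = v.1.1 ∧ (x : Equiv.Perm α).partition = w.1.1 := by
      rintro ⟨⟨S, hS⟩, hS1⟩ ⟨⟨T, x, hx, rfl⟩, hT1⟩ ⟨a, ha, e⟩
      dsimp only at e ⊢
      rw [← partition_pow] at e
      refine ⟨⟨x, ?_⟩, a, fun e' => hS1 (Subtype.ext ?_), e.symm, rfl⟩
      · exact fun e' => hT1 (Subtype.ext (partition_eq_partition_one_iff.2 e'))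
      · exact e.trans (partition_eq_partition_one_iff.2 e')
    obtain ⟨-, e | e⟩ := properTypeGraph_adj.1 hvw
    · obtain ⟨x, m, hm, hv, hw⟩ := key v w e
      exact ⟨x, m, hm, Or.inl ⟨Subtype.ext (Subtype.ext hv), Subtype.ext (Subtype.ext hw)⟩⟩
    · obtain ⟨x, m, hm, hv, hw⟩ := key w v e
      exact ⟨x, m, hm, Or.inr ⟨Subtype.ext (Subtype.ext hv), Subtype.ext (Subtype.ext hw)⟩⟩
  orderOf_eq e := orderOf_eq_of_partition_eq (congrArg (fun z => z.1.1) e)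
  pow_eq {x y} e m _ _ := by
    have e' : (x : Equiv.Perm α).partition = (y : Equiv.Perm α).partition :=
      congrArg (fun z => z.1.1) e
    refine Subtype.ext (Subtype.ext ?_)
    change ((x : Equiv.Perm α) ^ m).partition = ((y : Equiv.Perm α) ^ m).partition
    rw [partition_pow, partition_pow, e']

end Types

/-! ### Components of elements, and their stabilizers under conjugation. -/

section PowerConnected

variable {G : Type*} [Group G]

/-- Two elements different from `1` which lie in the same component of the proper power graph. -/
def PowerConnected (x y : G) : Prop :=
  ∃ (hx : x ∈ ({1}ᶜ : Set G)) (hy : y ∈ ({1}ᶜ : Set G)),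
    (properPowerGraph G).Reachable ⟨x, hx⟩ ⟨y, hy⟩

namespace PowerConnected

theorem refl {x : G} (hx : (orderOf x).Prime) : PowerConnected x x :=
  ⟨ne_one_of_prime_orderOf hx, ne_one_of_prime_orderOf hx, SimpleGraph.Reachable.refl _⟩

theorem symm {x y : G} (h : PowerConnected x y) : PowerConnected y x :=
  ⟨h.2.1, h.1, h.2.2.symm⟩

theorem trans {x y z : G} (h : PowerConnected x y) (h' : PowerConnected y z) :
    PowerConnected x z :=
  ⟨h.1, h'.2.1, h.2.2.trans h'.2.2⟩

theorem of_commute [Finite G] {x y : G} (hx : (orderOf x).Prime) (hy : (orderOf y).Prime)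
    (hne : orderOf x ≠ orderOf y) (hxy : Commute x y) : PowerConnected x y :=
  ⟨ne_one_of_prime_orderOf hx, ne_one_of_prime_orderOf hy,
    (isPowerQuotient_id G).reachable_of_commute hx hy hne hxy⟩

theorem map {H : Type*} [Group H] {φ : G →* H} (hφ : Function.Injective φ) {x y : G}
    (h : PowerConnected x y) : PowerConnected (φ x) (φ y) := by
  have h1 : ∀ x : ({1}ᶜ : Set G), φ x ∈ ({1}ᶜ : Set H) := fun x e =>
    x.2 ((map_eq_one_iff φ hφ).1 e)
  let F : properPowerGraph G →g properPowerGraph H :=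
    { toFun := fun x => ⟨φ x, h1 x⟩
      map_rel' := by
        intro a b hab
        obtain ⟨hne, e⟩ := properPowerGraph_adj.1 hab
        refine properPowerGraph_adj.2 ⟨fun e => hne (hφ e), ?_⟩
        simp only [← map_pow, hφ.eq_iff]
        exact e }
  exact ⟨h1 ⟨x, h.1⟩, h1 ⟨y, h.2.1⟩, h.2.2.map F⟩

theorem conj {x y : G} (h : PowerConnected x y) (g : G) :
    PowerConnected (g * x * g⁻¹) (g * y * g⁻¹) :=
  h.map (φ := (MulAut.conj g).toMonoidHom) (MulAut.conj g).injective

/-- The elements which conjugate `x` into its own component. -/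
def stabilizer (x : G) (hx : (orderOf x).Prime) : Subgroup G where
  carrier := {g | PowerConnected x (g * x * g⁻¹)}
  one_mem' := by simpa using refl hx
  mul_mem' {a b} ha hb := by
    have := ha.trans (hb.conj a)
    simpa [mul_assoc] using this
  inv_mem' {a} ha := by
    have := (ha.conj a⁻¹).symm
    simpa [mul_assoc] using this

/-- Conjugation by `g` permutes the components and fixes `y`, hence preserves the component of `y`,
which is that of `x`. -/
theorem mem_stabilizer_of_commute {x y g : G} {hx : (orderOf x).Prime} (h : PowerConnected x y)
    (hg : Commute g y) : g ∈ stabilizer x hx := by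
  have e := h.conj g
  rw [hg.eq, mul_inv_cancel_right] at e
  exact h.trans e.symm

end PowerConnected

end PowerConnected

/-! ### Commuting permutations of prime order, and links between involutions. -/

section Perm

open Equiv Equiv.Perm

variable {α : Type*} [DecidableEq α]

theorem dvd_card_of_forall_ne {p : ℕ} (hp : p.Prime) {x : Perm α} (hx : x ^ p = 1)
    (S : Finset α) (hS : ∀ i, x i ∈ S ↔ i ∈ S) (hmove : ∀ i ∈ S, x i ≠ i) : p ∣ S.card := by
  have := Fact.mk hp
  have h1 : (x.subtypePerm hS) ^ p ^ 1 = 1 := by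
    ext i
    simp [subtypePerm_pow, hx]
  have h2 := card_compl_support_modEq h1
  have h3 : (x.subtypePerm hS).supportᶜ = ∅ := by
    ext i
    simpa [Subtype.ext_iff] using hmove i i.2
  rw [h3, Finset.card_empty, Fintype.card_coe] at h2
  exact (Nat.modEq_zero_iff_dvd).1 h2.symm

theorem commute_swap_of_apply_eq {x : Perm α} {a b : α} (ha : x a = a) (hb : x b = b) :
    Commute x (swap a b) := by
  rw [Commute, SemiconjBy, mul_swap_eq_swap_mul, ha, hb]

variable [Fintype α]

theorem apply_mem_support_of_commute {x y : Perm α} (h : Commute x y) (i : α) :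
    x i ∈ y.support ↔ i ∈ y.support := by
  rw [mem_support, mem_support, ← Perm.mul_apply, ← h.eq, Perm.mul_apply, Ne, x.injective.eq_iff]

/-- The group generated by `x` and `y` has orbits of sizes `1`, `orderOf x`, `orderOf y` and
`orderOf x * orderOf y`, and `a`, `b`, `c`, `d` count them. On the common part of the supports
neither permutation has a fixed point, so both primes divide its size. -/
theorem exists_card_orbits_of_commute {x y : Perm α} (hx : (orderOf x).Prime)
    (hy : (orderOf y).Prime) (hne : orderOf x ≠ orderOf y) (h : Commute x y) :
    ∃ a b c d : ℕ, a + orderOf x * b + orderOf y * c + orderOf x * orderOf y * d =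
      Fintype.card α ∧ x.support.card = orderOf x * b + orderOf x * orderOf y * d ∧
      y.support.card = orderOf y * c + orderOf x * orderOf y * d ∧
      (x.support ∩ y.support).card = orderOf x * orderOf y * d := by
  have hxx := fun i => apply_mem_support_of_commute (Commute.refl x) i
  have hyy := fun i => apply_mem_support_of_commute (Commute.refl y) i
  have hxy := fun i => apply_mem_support_of_commute h i
  have hyx := fun i => apply_mem_support_of_commute h.symm i
  obtain ⟨b, hb⟩ := dvd_card_of_forall_ne hx (pow_orderOf_eq_one x) (x.support \ y.support)
    (fun i => by rw [Finset.mem_sdiff, Finset.mem_sdiff, hxx, hxy])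
    (fun i hi => mem_support.1 (Finset.mem_sdiff.1 hi).1)
  obtain ⟨c, hc⟩ := dvd_card_of_forall_ne hy (pow_orderOf_eq_one y) (y.support \ x.support)
    (fun i => by rw [Finset.mem_sdiff, Finset.mem_sdiff, hyy, hyx])
    (fun i hi => mem_support.1 (Finset.mem_sdiff.1 hi).1)
  have h1 := dvd_card_of_forall_ne hx (pow_orderOf_eq_one x) (x.support ∩ y.support)
    (fun i => by rw [Finset.mem_inter, Finset.mem_inter, hxx, hxy])
    (fun i hi => mem_support.1 (Finset.mem_inter.1 hi).1)
  have h2 := dvd_card_of_forall_ne hy (pow_orderOf_eq_one y) (x.support ∩ y.support)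
    (fun i => by rw [Finset.mem_inter, Finset.mem_inter, hyy, hyx])
    (fun i hi => mem_support.1 (Finset.mem_inter.1 hi).2)
  obtain ⟨d, hd⟩ := ((Nat.coprime_primes hx hy).2 hne).mul_dvd_of_dvd_of_dvd h1 h2
  have e1 := Finset.card_sdiff_add_card_inter x.support y.support
  have e2 := Finset.card_sdiff_add_card_inter y.support x.support
  rw [Finset.inter_comm] at e2
  have e3 := Finset.card_union_add_card_inter x.support y.support
  have e4 := Finset.card_le_univ (x.support ∪ y.support)
  refine ⟨Fintype.card α - (x.support ∪ y.support).card, b, c, d, ?_, ?_, ?_, hd⟩ <;> omega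

/-- If `x` has `k + 1` cycles, the order of its centralizer has the factors `(k + 1)!` and the
factorial of the number of fixed points. The first is even for `k > 0`; for `k = 0` the hypotheses
leave at least two fixed points. Cauchy's theorem gives the involution. -/
theorem exists_orderOf_two_commute {x : Perm α} (hx : (orderOf x).Prime)
    (hn : orderOf x ≠ Fintype.card α) (hn' : orderOf x + 1 ≠ Fintype.card α) :
    ∃ y : Perm α, orderOf y = 2 ∧ Commute x y := by
  obtain ⟨k, hk⟩ := cycleType_prime_order hx
  have hle := sum_cycleType_le x
  have hcard := nat_card_centralizer x
  rw [hk, Multiset.sum_replicate, Multiset.prod_replicate, smul_eq_mul,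
    Multiset.toFinset_replicate, if_neg (Nat.succ_ne_zero k), Finset.prod_singleton,
    Multiset.count_replicate_self] at hcard
  rw [hk, Multiset.sum_replicate, smul_eq_mul] at hle
  have : Fact (Nat.Prime 2) := ⟨Nat.prime_two⟩
  have hdvd : 2 ∣ Nat.card (Subgroup.centralizer {x}) := by
    rw [hcard]
    rcases Nat.eq_zero_or_pos k with rfl | hk0
    · refine Dvd.dvd.mul_right (Dvd.dvd.mul_right (Nat.dvd_factorial two_pos ?_) _) _
      omega
    · exact Dvd.dvd.mul_left (Nat.dvd_factorial two_pos (by omega)) _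
  obtain ⟨y, hy⟩ := exists_prime_orderOf_dvd_card' 2 hdvd
  refine ⟨y, by rwa [Subgroup.orderOf_coe], ?_⟩
  exact (Subgroup.mem_centralizer_singleton_iff.1 y.2).symm

theorem orderOf_swap {a b : α} (h : a ≠ b) : orderOf (swap a b) = 2 :=
  IsSwap.orderOf ⟨a, b, h, rfl⟩

theorem prime_orderOf_swap {a b : α} (h : a ≠ b) : (orderOf (swap a b)).Prime := by
  rw [orderOf_swap h]
  exact Nat.prime_two

theorem powerConnected_swap_of_apply_eq {x : Perm α} (hx : (orderOf x).Prime)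
    (h2 : orderOf x ≠ 2) {a b : α} (hab : a ≠ b) (ha : x a = a) (hb : x b = b) :
    PowerConnected x (swap a b) :=
  .of_commute hx (prime_orderOf_swap hab) (by rwa [orderOf_swap hab])
    (commute_swap_of_apply_eq ha hb)

theorem exists_ne_of_card_lt (s : Finset α) {k : ℕ} (h : s.card + k ≤ Fintype.card α) :
    k ≤ sᶜ.card := by
  rw [Finset.card_compl]
  omega

theorem orderOf_three_cycle {d e f : α} (hde : d ≠ e) (hdf : d ≠ f) (hef : e ≠ f) :
    orderOf (swap d e * swap d f) = 3 :=
  (isThreeCycle_swap_mul_swap_same hde hdf hef).orderOf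

/-- Degree `6` leaves room for a `3`-cycle away from `a`, `b`, `c`, which commutes with both
transpositions. -/
theorem powerConnected_swap_swap_left (hα : 6 ≤ Fintype.card α) {a b c : α} (hab : a ≠ b)
    (hac : a ≠ c) : PowerConnected (swap a b) (swap a c) := by
  have h3 : 2 < ({a, b, c} : Finset α)ᶜ.card :=
    exists_ne_of_card_lt _ (k := 3) (by have := Finset.card_le_three (a := a) (b := b) (c := c); omega)
  obtain ⟨d, hd, e, he, f, hf, hde, hdf, hef⟩ := Finset.two_lt_card.1 h3
  simp only [Finset.mem_compl, Finset.mem_insert, Finset.mem_singleton, not_or] at hd he hf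
  have ho := orderOf_three_cycle hde hdf hef
  have hp : (orderOf (swap d e * swap d f)).Prime := ho ▸ Nat.prime_three
  have hfix : ∀ i, i ≠ d → i ≠ e → i ≠ f → (swap d e * swap d f) i = i := by
    intro i h1 h2 h3
    rw [Perm.mul_apply, swap_apply_of_ne_of_ne h1 h3, swap_apply_of_ne_of_ne h1 h2]
  have ha := hfix a (Ne.symm hd.1) (Ne.symm he.1) (Ne.symm hf.1)
  have hb := hfix b (Ne.symm hd.2.1) (Ne.symm he.2.1) (Ne.symm hf.2.1)
  have hc := hfix c (Ne.symm hd.2.2) (Ne.symm he.2.2) (Ne.symm hf.2.2)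
  exact (powerConnected_swap_of_apply_eq hp (by omega) hab ha hb).symm.trans
    (powerConnected_swap_of_apply_eq hp (by omega) hac ha hc)

theorem powerConnected_swap_swap (hα : 6 ≤ Fintype.card α) {a b c d : α} (hab : a ≠ b)
    (hcd : c ≠ d) : PowerConnected (swap a b) (swap c d) := by
  by_cases hac : a = c
  · subst hac
    exact powerConnected_swap_swap_left hα hab hcd
  · have h1 := powerConnected_swap_swap_left hα hab hac
    rw [swap_comm a c] at h1
    exact h1.trans (powerConnected_swap_swap_left hα (Ne.symm hac) hcd)

/-- A `3`-cycle on three fixed points of `x` commutes with `x` and with a transposition of two other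
points. -/
theorem exists_powerConnected_swap_of_card_support_le (hα : 6 ≤ Fintype.card α) {x : Perm α}
    (hx : orderOf x = 2) (hs : x.support.card + 3 ≤ Fintype.card α) :
    ∃ a b : α, a ≠ b ∧ PowerConnected x (swap a b) := by
  obtain ⟨d, hd, e, he, f, hf, hde, hdf, hef⟩ :=
    Finset.two_lt_card.1 (exists_ne_of_card_lt _ hs)
  rw [Finset.mem_compl, notMem_support] at hd he hf
  have ho := orderOf_three_cycle hde hdf hef
  have h3 : 1 < ({d, e, f} : Finset α)ᶜ.card :=
    exists_ne_of_card_lt _ (k := 2) (by have := Finset.card_le_three (a := d) (b := e) (c := f); omega)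
  obtain ⟨a, ha, b, hb, hab⟩ := Finset.one_lt_card.1 h3
  simp only [Finset.mem_compl, Finset.mem_insert, Finset.mem_singleton, not_or] at ha hb
  have hp : (orderOf (swap d e * swap d f)).Prime := ho ▸ Nat.prime_three
  have hfix : ∀ i, i ≠ d → i ≠ e → i ≠ f → (swap d e * swap d f) i = i := by
    intro i h1 h2 h3
    rw [Perm.mul_apply, swap_apply_of_ne_of_ne h1 h3, swap_apply_of_ne_of_ne h1 h2]
  refine ⟨a, b, hab, .trans (.of_commute (hx ▸ Nat.prime_two) hp (by omega) ?_)
    (powerConnected_swap_of_apply_eq hp (by omega) hab (hfix a ha.1 ha.2.1 ha.2.2)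
      (hfix b hb.1 hb.2.1 hb.2.2))⟩
  exact (commute_swap_of_apply_eq hd he).mul_right (commute_swap_of_apply_eq hd hf)

/-- An element of order `3` that permutes three of the transpositions of `x` cyclically commutes
with `x` and moves only six points; degree `8` leaves two points to transpose. -/
theorem exists_powerConnected_swap_of_six_le_card_support (hα : 8 ≤ Fintype.card α) {x : Perm α}
    (hx : orderOf x = 2) (hs : 6 ≤ x.support.card) :
    ∃ a b : α, a ≠ b ∧ PowerConnected x (swap a b) := by
  have hxx : ∀ i, x (x i) = i := fun i => by
    rw [← Perm.mul_apply, ← sq, ← hx, pow_orderOf_eq_one, Perm.one_apply]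
  have hpick : ∀ s : Finset α, s.card ≤ 4 → ∃ a, x a ≠ a ∧ a ∉ s := by
    intro s h
    have : 0 < (x.support \ s).card := by
      have := Finset.le_card_sdiff s x.support
      omega
    obtain ⟨a, ha⟩ := Finset.card_pos.1 this
    rw [Finset.mem_sdiff, mem_support] at ha
    exact ⟨a, ha⟩
  obtain ⟨a, ha, -⟩ := hpick ∅ (by simp)
  obtain ⟨b, hb, hb'⟩ := hpick {a, x a} (Finset.card_le_two.trans (by omega))
  obtain ⟨c, hc, hc'⟩ := hpick {a, x a, b, x b} Finset.card_le_four
  simp only [Finset.mem_insert, Finset.mem_singleton, not_or] at hb' hc'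
  have hab : a ≠ b := Ne.symm hb'.1
  have hac : a ≠ c := Ne.symm hc'.1
  have hbc : b ≠ c := Ne.symm hc'.2.2.1
  have hswap : ∀ {i j : α}, i ≠ j → x i ≠ x j := fun h e => h (x.injective e)
  have hflip : ∀ {i j : α}, i ≠ x j → x i ≠ j := fun h e => h (by rw [← e, hxx])
  have hc6 : 1 < ({a, b, c, x a, x b, x c} : Finset α)ᶜ.card :=
    exists_ne_of_card_lt _ (k := 2)
      (by have := Finset.card_le_six (a := a) (b := b) (c := c) (d := x a) (e := x b) (f := x c); omega)
  obtain ⟨g, hg, h, hh, hgh⟩ := Finset.one_lt_card.1 hc6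
  simp only [Finset.mem_compl, Finset.mem_insert, Finset.mem_singleton, not_or] at hg hh
  set t := swap a b * swap a c with ht
  -- `u` is the conjugate of `t` by `x`. The involution `x` exchanges `t` and `u`, which commute, so
  -- it commutes with `t * u`.
  set u := swap (x a) (x b) * swap (x a) (x c) with hu
  have hxt : x * t = u * x := by
    rw [ht, hu, ← mul_assoc, mul_swap_eq_swap_mul x, mul_assoc, mul_swap_eq_swap_mul x, ← mul_assoc]
  have hxu : x * u = t * x := by
    rw [ht, hu, ← mul_assoc, mul_swap_eq_swap_mul x, mul_assoc, mul_swap_eq_swap_mul x, ← mul_assoc,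
      hxx, hxx, hxx]
  have htfix : ∀ i, i ≠ a → i ≠ b → i ≠ c → t i = i := by
    intro i h1 h2 h3
    rw [ht, Perm.mul_apply, swap_apply_of_ne_of_ne h1 h3, swap_apply_of_ne_of_ne h1 h2]
  have hufix : ∀ i, i ≠ x a → i ≠ x b → i ≠ x c → u i = i := by
    intro i h1 h2 h3
    rw [hu, Perm.mul_apply, swap_apply_of_ne_of_ne h1 h3, swap_apply_of_ne_of_ne h1 h2]
  have hta := htfix (x a) ha (Ne.symm hb'.2) (Ne.symm hc'.2.1)
  have htb := htfix (x b) (hflip hb'.2) hb (Ne.symm hc'.2.2.2)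
  have htc := htfix (x c) (hflip hc'.2.1) (hflip hc'.2.2.2) hc
  have htu : Commute t u :=
    (commute_swap_of_apply_eq hta htb).mul_right (commute_swap_of_apply_eq hta htc)
  have hcomm : Commute x (t * u) := by
    rw [Commute, SemiconjBy, ← mul_assoc, hxt, mul_assoc, hxu, ← mul_assoc, htu.eq]
  have ho : orderOf (t * u) = 3 := by
    have : Fact (Nat.Prime 3) := ⟨Nat.prime_three⟩
    refine orderOf_eq_prime ?_ fun e => ?_
    · rw [htu.mul_pow, ← orderOf_three_cycle hab hac hbc, pow_orderOf_eq_one, one_mul,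
        orderOf_three_cycle hab hac hbc,
        ← orderOf_three_cycle (hswap hab) (hswap hac) (hswap hbc), pow_orderOf_eq_one]
    · have e1 : (t * u) a = a := by rw [e, Perm.one_apply]
      rw [Perm.mul_apply, hufix a (Ne.symm ha) (Ne.symm (hflip hb'.2)) (Ne.symm (hflip hc'.2.1)),
        ht, Perm.mul_apply, swap_apply_left, swap_apply_of_ne_of_ne (Ne.symm hac) (Ne.symm hbc)] at e1
      exact hac e1.symm
  have hp : (orderOf (t * u)).Prime := ho ▸ Nat.prime_three
  refine ⟨g, h, hgh, .trans (.of_commute (hx ▸ Nat.prime_two) hp (by omega) hcomm)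
    (powerConnected_swap_of_apply_eq hp (by omega) hgh ?_ ?_)⟩
  · rw [Perm.mul_apply, hufix g hg.2.2.2.1 hg.2.2.2.2.1 hg.2.2.2.2.2,
      htfix g hg.1 hg.2.1 hg.2.2.1]
  · rw [Perm.mul_apply, hufix h hh.2.2.2.1 hh.2.2.2.2.1 hh.2.2.2.2.2,
      htfix h hh.1 hh.2.1 hh.2.2.1]

theorem powerConnected_of_exists_swap (hα : 6 ≤ Fintype.card α) {x y : Perm α}
    (hx : ∃ a b : α, a ≠ b ∧ PowerConnected x (swap a b))
    (hy : ∃ a b : α, a ≠ b ∧ PowerConnected y (swap a b)) : PowerConnected x y := by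
  obtain ⟨a, b, hab, h⟩ := hx
  obtain ⟨c, d, hcd, h'⟩ := hy
  exact (h.trans (powerConnected_swap_swap hα hab hcd)).trans h'.symm

theorem powerConnected_of_card_support_le (hα : 6 ≤ Fintype.card α) {x y : Perm α}
    (hx : orderOf x = 2) (hy : orderOf y = 2) (hxs : x.support.card + 3 ≤ Fintype.card α)
    (hys : y.support.card + 3 ≤ Fintype.card α) : PowerConnected x y :=
  powerConnected_of_exists_swap hα (exists_powerConnected_swap_of_card_support_le hα hx hxs)
    (exists_powerConnected_swap_of_card_support_le hα hy hys)

theorem powerConnected_of_eight_le_card (hα : 8 ≤ Fintype.card α) {x y : Perm α}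
    (hx : orderOf x = 2) (hy : orderOf y = 2) : PowerConnected x y := by
  have key : ∀ z : Perm α, orderOf z = 2 → ∃ a b : α, a ≠ b ∧ PowerConnected z (swap a b) := by
    intro z hz
    -- With fewer than three fixed points, at least `8 - 2 = 6` points are moved.
    by_cases h : z.support.card + 3 ≤ Fintype.card α
    · exact exists_powerConnected_swap_of_card_support_le (by omega) hz h
    · exact exists_powerConnected_swap_of_six_le_card_support hα hz (by omega)
  exact powerConnected_of_exists_swap (by omega) (key x hx) (key y hy)

theorem isConj_of_orderOf_eq {x y : Perm α} (hx : (orderOf x).Prime) (h : orderOf x = orderOf y)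
    (hs : x.support.card = y.support.card) : IsConj x y := by
  obtain ⟨k, hk⟩ := cycleType_prime_order hx
  obtain ⟨l, hl⟩ := cycleType_prime_order (h ▸ hx)
  rw [← sum_cycleType, ← sum_cycleType, hk, hl, Multiset.sum_replicate, Multiset.sum_replicate,
    ← h, smul_eq_mul, smul_eq_mul] at hs
  rw [isConj_iff_cycleType_eq, hk, hl, Nat.eq_of_mul_eq_mul_right hx.pos hs, h]

/-- The square of the `6`-cycle `finRotate 6` permutes the three pairs of `t`, so it is linked to
`t`. Hence `finRotate 6` stabilizes the component of `t`, and so does `swap 0 1`, which commutes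
with `t`. These two generate the whole group, under which all such involutions are conjugate. -/
theorem powerConnected_fin_six {x y : Perm (Fin 6)} (hx : orderOf x = 2) (hy : orderOf y = 2)
    (hxs : x.support.card = 6) (hys : y.support.card = 6) : PowerConnected x y := by
  have : Fact (Nat.Prime 2) := ⟨Nat.prime_two⟩
  have : Fact (Nat.Prime 3) := ⟨Nat.prime_three⟩
  set t : Perm (Fin 6) := swap 0 1 * swap 2 3 * swap 4 5 with ht
  have ho : orderOf t = 2 := orderOf_eq_prime (by decide) (by decide)
  have hts : t.support.card = 6 := by decide
  have hp : (orderOf t).Prime := ho ▸ Nat.prime_two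
  have hz : orderOf (finRotate 6 ^ 2) = 3 := orderOf_eq_prime (by decide) (by decide)
  have htz : PowerConnected t (finRotate 6 ^ 2) :=
    .of_commute hp (hz ▸ Nat.prime_three) (by omega) (by unfold Commute SemiconjBy; decide)
  have h1 : finRotate 6 ∈ PowerConnected.stabilizer t hp :=
    PowerConnected.mem_stabilizer_of_commute htz ((Commute.refl _).pow_right 2)
  have h2 : swap 0 1 ∈ PowerConnected.stabilizer t hp :=
    PowerConnected.mem_stabilizer_of_commute (.refl hp) (by unfold Commute SemiconjBy; decide)
  have htop : PowerConnected.stabilizer t hp = ⊤ := by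
    rw [eq_top_iff, ← closure_cycle_adjacent_swap (isCycle_finRotate (n := 4))
      (support_finRotate (n := 4)) 0, Subgroup.closure_le]
    rintro g (rfl | rfl)
    · exact h1
    · exact h2
  have key : ∀ y : Perm (Fin 6), orderOf y = 2 → y.support.card = 6 → PowerConnected t y := by
    intro y hy hys
    obtain ⟨g, rfl⟩ := isConj_iff.1 (isConj_of_orderOf_eq hp (ho.trans hy.symm) (hts.trans hys.symm))
    have : g ∈ PowerConnected.stabilizer t hp := htop ▸ Subgroup.mem_top g
    exact this
  exact (key x hx hxs).symm.trans (key y hy hys)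

/-- Restriction to the common support reduces this to degree `6`. -/
theorem powerConnected_of_support_eq {x y : Perm α} (hx : orderOf x = 2) (hy : orderOf y = 2)
    (hxs : x.support.card = 6) (hxy : x.support = y.support) : PowerConnected x y := by
  let e : {i // i ∈ x.support} ≃ Fin 6 := x.support.equivFinOfCardEq hxs
  let φ : Perm (Fin 6) →* Perm α :=
    (ofSubtype (p := (· ∈ x.support))).comp e.symm.permCongrHom.toMonoidHom
  have hφ : Function.Injective φ := ofSubtype_injective.comp e.symm.permCongrHom.injective
  have key : ∀ y : Perm α, orderOf y = 2 → y.support = x.support →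
      ∃ z, φ z = y ∧ orderOf z = 2 ∧ z.support.card = 6 := by
    intro y hy hys
    have h1 : ∀ i, y i ∈ x.support ↔ i ∈ x.support := by
      rw [← hys]; exact apply_mem_support_of_commute (Commute.refl y)
    have h2 : ∀ i, y i ≠ i → i ∈ x.support := fun i hi => hys ▸ mem_support.2 hi
    have h3 : φ (e.permCongr (y.subtypePerm h1)) = y := by
      change ofSubtype (e.symm.permCongr (e.permCongr (y.subtypePerm h1))) = y
      conv_rhs => rw [← ofSubtype_subtypePerm h1 h2]
      congr 1
      ext i
      simp
    refine ⟨_, h3, ?_, ?_⟩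
    · rw [← orderOf_injective φ hφ, h3, hy]
    · have : (e.permCongr (y.subtypePerm h1)).support = Finset.univ := by
        ext i
        rw [mem_support]
        simp only [Finset.mem_univ, iff_true, permCongr_apply]
        intro h
        have h' := congrArg e.symm h
        rw [e.symm_apply_apply] at h'
        have h4 := congrArg Subtype.val h'
        exact mem_support.1 (by rw [hys]; exact (e.symm i).2) h4
      rw [this]
      simp
  obtain ⟨u, hu, hu2, hu6⟩ := key x hx rfl
  obtain ⟨v, hv, hv2, hv6⟩ := key y hy hxy.symm
  rw [← hu, ← hv]
  exact (powerConnected_fin_six hu2 hv2 hu6 hv6).map hφ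

end Perm

/-! ### Counting components with the top prime set apart. -/

section PrimeOrder

open Equiv Equiv.Perm

/-- Each subgroup of order `p` has `p - 1` generators. -/
theorem card_zpowers_image_mul {G : Type*} [Group G] [Fintype G] [DecidableEq G] {p : ℕ}
    (hp : p.Prime) :
    (Subgroup.zpowers '' {x : G | orderOf x = p}).ncard * (p - 1) =
      (Finset.univ.filter fun x : G => orderOf x = p).card := by
  classical
  set S := Finset.univ.filter fun x : G => orderOf x = p with hS
  have h1 : Subgroup.zpowers '' {x : G | orderOf x = p} = (S.image Subgroup.zpowers : Finset _) := by
    ext H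
    simp [hS]
  rw [h1, Set.ncard_coe_finset, Finset.card_eq_sum_card_image Subgroup.zpowers S,
    Finset.sum_const_nat (m := p - 1)]
  intro H hH
  obtain ⟨x, hx, rfl⟩ := Finset.mem_image.1 hH
  rw [hS, Finset.mem_filter] at hx
  have h2 : S.filter (fun a => Subgroup.zpowers a = Subgroup.zpowers x) =
      (Finset.univ.filter (· ∈ Subgroup.zpowers x)).erase 1 := by
    ext a
    simp only [hS, Finset.mem_filter, Finset.mem_univ, true_and, Finset.mem_erase]
    constructor
    · rintro ⟨ha, e⟩
      refine ⟨?_, e ▸ Subgroup.mem_zpowers a⟩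
      rintro rfl
      rw [orderOf_one] at ha
      exact hp.ne_one ha.symm
    · rintro ⟨ha, e⟩
      have ho : orderOf a = p := by
        have hd := orderOf_dvd_of_mem_zpowers e
        rw [hx.2] at hd
        exact (hp.eq_one_or_self_of_dvd _ hd).resolve_left fun h => ha (orderOf_eq_one_iff.1 h)
      exact ⟨ho, zpowers_eq_of_mem_zpowers e (Subgroup.mem_zpowers x) (ho.trans hx.2.symm)⟩
  rw [h2, Finset.card_erase_of_mem (by simp [one_mem]), ← hx.2, ← Nat.card_zpowers,
    Nat.card_eq_fintype_card, Fintype.card_subtype]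

variable {α : Type*} [Fintype α] [DecidableEq α]

theorem cycleType_eq_singleton_iff {p : ℕ} (hp : p.Prime) (hn : Fintype.card α < 2 * p)
    (x : Perm α) : x.cycleType = {p} ↔ orderOf x = p := by
  constructor
  · intro h
    rw [← lcm_cycleType, h, Multiset.lcm_singleton, normalize_eq]
  · rintro rfl
    have := Finset.card_le_univ x.support
    have hc := isCycle_of_prime_order hp (by omega)
    rw [hc.cycleType, hc.orderOf]

/-- There are `n! / p` cycles of length `p`, because `(n - p)! = 1`. -/
theorem card_zpowers_image_mul_eq_factorial {p : ℕ} (hp : p.Prime)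
    (hpn : p = Fintype.card α ∨ p + 1 = Fintype.card α) :
    (Subgroup.zpowers '' {x : Perm α | orderOf x = p}).ncard * ((p - 1) * p) =
      (Fintype.card α).factorial := by
  have h2 := hp.two_le
  have h := card_of_cycleType_mul_eq α {p}
  have hf : (Fintype.card α - p).factorial = 1 := by
    rcases hpn with e | e
    · rw [← e, Nat.sub_self, Nat.factorial_zero]
    · rw [← e, Nat.add_sub_cancel_left, Nat.factorial_one]
  rw [Multiset.sum_singleton, Multiset.prod_singleton, Multiset.toFinset_singleton,
    Finset.prod_singleton, Multiset.count_singleton_self, Nat.factorial_one, hf, one_mul, mul_one,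
    if_pos ⟨by omega, by simpa using h2⟩] at h
  rw [← mul_assoc, card_zpowers_image_mul hp, ← h]
  congr 3
  ext x
  exact (cycleType_eq_singleton_iff hp (by omega) x).symm

theorem orderOf_le_card {x : Perm α} (hx : (orderOf x).Prime) : orderOf x ≤ Fintype.card α := by
  obtain ⟨k, hk⟩ := cycleType_prime_order hx
  refine le_trans ?_ (sum_cycleType_le x)
  rw [hk, Multiset.sum_replicate, smul_eq_mul]
  exact Nat.le_mul_of_pos_left _ k.succ_pos

theorem card_support_pos {x : Perm α} (hx : (orderOf x).Prime) : 0 < x.support.card := by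
  rw [Finset.card_pos, Finset.nonempty_iff_ne_empty, Ne, support_eq_empty_iff]
  exact ne_one_of_prime_orderOf hx

/-- Commuting would require either disjoint orbits of sizes `orderOf x` and `orderOf y` or an orbit
of at least `2 * orderOf x` points; neither fits into `orderOf x + 1` points. -/
theorem not_commute_of_card_le_orderOf_add_one {x y : Perm α} (hx : (orderOf x).Prime)
    (hy : (orderOf y).Prime) (hne : orderOf x ≠ orderOf y)
    (hn : Fintype.card α ≤ orderOf x + 1) : ¬ Commute x y := by
  intro h
  obtain ⟨a, b, c, d, h1, h2, h3, -⟩ := exists_card_orbits_of_commute hx hy hne h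
  have hxs := card_support_pos hx
  have hys := card_support_pos hy
  have hx2 := hx.two_le
  have hy2 := hy.two_le
  rcases Nat.eq_zero_or_pos d with rfl | hd
  · have hb : 0 < b := Nat.pos_of_ne_zero (by rintro rfl; rw [Nat.mul_zero, Nat.mul_zero] at h2; omega)
    have hc : 0 < c := Nat.pos_of_ne_zero (by rintro rfl; rw [Nat.mul_zero, Nat.mul_zero] at h3; omega)
    have := Nat.le_mul_of_pos_right (orderOf x) hb
    have := Nat.le_mul_of_pos_right (orderOf y) hc
    omega
  · have e1 := Nat.mul_le_mul_left (orderOf x) hy2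
    have e2 := Nat.le_mul_of_pos_right (orderOf x * orderOf y) hd
    omega

theorem support_eq_of_zpowers_eq {x y : Perm α} (h : Subgroup.zpowers x = Subgroup.zpowers y) :
    x.support = y.support := by
  have key : ∀ {x y : Perm α}, Subgroup.zpowers x = Subgroup.zpowers y →
      x.support ⊆ y.support := by
    intro x y h
    obtain ⟨k, rfl⟩ := Subgroup.mem_zpowers_iff.1 (h ▸ Subgroup.mem_zpowers x)
    exact support_zpow_le y k
  exact (key h).antisymm (key h.symm)

theorem orderOf_eq_of_zpowers_eq {G : Type*} [Group G] {x y : G}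
    (h : Subgroup.zpowers x = Subgroup.zpowers y) : orderOf x = orderOf y := by
  rw [← Nat.card_zpowers, h, Nat.card_zpowers]

/-- `p` is the number of degree `n` or `n - 1` which may be an odd prime. -/
structure IsTopPrime (n p : ℕ) : Prop where
  eq_or_eq : p = n ∨ p + 1 = n
  ne_two : p ≠ 2
  eq_of_prime : ∀ q : ℕ, q.Prime → q ≠ 2 → q = n ∨ q + 1 = n → q = p

theorem image_union_image_ncard {G κ ι : Type*} [Finite G] (k : G → κ) (g : G → ι) (s t u : Set G)
    (hst : ∀ x ∈ s, x ∉ t) (hu : u = s ∪ t) [DecidablePred (· ∈ s)] :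
    ((fun x => if x ∈ s then Sum.inl (k x) else Sum.inr (g x) : G → κ ⊕ ι) '' u).ncard =
      (k '' s).ncard + (g '' t).ncard := by
  have h1 : (fun x => if x ∈ s then Sum.inl (k x) else Sum.inr (g x) : G → κ ⊕ ι) '' u =
      Sum.inl '' (k '' s) ∪ Sum.inr '' (g '' t) := by
    rw [hu, Set.image_union, Set.image_image, Set.image_image]
    congr 1
    · exact Set.image_congr fun x hx => if_pos hx
    · exact Set.image_congr fun x hx => if_neg fun hx' => hst x hx' hx
  rw [h1, Set.ncard_union_eq ?_ (Set.toFinite _) (Set.toFinite _),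
    Set.ncard_image_of_injective _ Sum.inl_injective,
    Set.ncard_image_of_injective _ Sum.inr_injective]
  rw [Set.disjoint_left]
  rintro _ ⟨x, -, rfl⟩ ⟨y, -, e⟩
  exact Sum.inr_ne_inl e

variable {W : Type*} {X : SimpleGraph W} {π : ({1}ᶜ : Set (Perm α)) → W}

/-- The components of a quotient of the power graph of a symmetric group, counted by an invariant
`k` of the elements of order `p`, which commute with no element of another prime order, and an
invariant `g` of the other elements of prime order, each of which is linked to an involution. -/
theorem IsPowerQuotient.numComponents_perm_eq (h : IsPowerQuotient X π) {p : ℕ}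
    (hp : IsTopPrime (Fintype.card α) p) {κ ι : Type*} (k : Perm α → κ) (g : Perm α → ι)
    (kz : ∀ x y, p.Prime → orderOf x = p → Subgroup.zpowers x = Subgroup.zpowers y → k x = k y)
    (kπ : ∀ x y : ({1}ᶜ : Set (Perm α)), p.Prime → orderOf (x : Perm α) = p → π x = π y → k x = k y)
    (kr : ∀ x y : ({1}ᶜ : Set (Perm α)), p.Prime → orderOf (x : Perm α) = p →
      orderOf (y : Perm α) = p → k x = k y → X.Reachable (π x) (π y))
    (gz : ∀ x y, (orderOf x).Prime → orderOf x ≠ p →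
      Subgroup.zpowers x = Subgroup.zpowers y → g x = g y)
    (gc : ∀ x y, (orderOf x).Prime → (orderOf y).Prime → orderOf x ≠ p → orderOf y ≠ p →
      orderOf x < orderOf y → Commute x y → g x = g y)
    (gπ : ∀ x y : ({1}ᶜ : Set (Perm α)), (orderOf (x : Perm α)).Prime →
      orderOf (x : Perm α) ≠ p → π x = π y → g x = g y)
    (gr : ∀ x y : ({1}ᶜ : Set (Perm α)), orderOf (x : Perm α) = 2 → orderOf (y : Perm α) = 2 →
      g x = g y → X.Reachable (π x) (π y)) :
    numComponents X = (k '' {x | p.Prime ∧ orderOf x = p}).ncard +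
      (g '' {x | orderOf x = 2}).ncard := by
  classical
  have gc' : ∀ x y, (orderOf x).Prime → (orderOf y).Prime → orderOf x ≠ p → orderOf y ≠ p →
      orderOf x ≠ orderOf y → Commute x y → g x = g y := by
    intro x y hx hy hxp hyp hne hc
    rcases lt_or_gt_of_ne hne with e | e
    · exact gc x y hx hy hxp hyp e hc
    · exact (gc y x hy hx hyp hxp e hc.symm).symm
  have hnc : ∀ x y : Perm α, (orderOf x).Prime → (orderOf y).Prime → orderOf x ≠ orderOf y →
      orderOf x = p → ¬ Commute x y := by
    intro x y hx hy hne hxp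
    refine not_commute_of_card_le_orderOf_add_one hx hy hne ?_
    have := hp.eq_or_eq
    omega
  -- The involution found here represents both the value of `g` at `x` and the component of `x`.
  have hinv : ∀ x : Perm α, (orderOf x).Prime → orderOf x ≠ p →
      ∃ y : Perm α, ∃ hx : x ∈ ({1}ᶜ : Set (Perm α)), ∃ hy : y ∈ ({1}ᶜ : Set (Perm α)),
        orderOf y = 2 ∧ g x = g y ∧ X.Reachable (π ⟨x, hx⟩) (π ⟨y, hy⟩) := by
    intro x hx hxp
    by_cases h2 : orderOf x = 2
    · exact ⟨x, ne_one_of_prime_orderOf hx, ne_one_of_prime_orderOf hx, h2, rfl,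
        SimpleGraph.Reachable.refl _⟩
    · obtain ⟨y, hy, hxy⟩ := exists_orderOf_two_commute hx
        (fun e => hxp (hp.eq_of_prime _ hx h2 (Or.inl e)))
        (fun e => hxp (hp.eq_of_prime _ hx h2 (Or.inr e)))
      have hy' : (orderOf y).Prime := hy ▸ Nat.prime_two
      have hne : orderOf x ≠ orderOf y := by omega
      exact ⟨y, ne_one_of_prime_orderOf hx, ne_one_of_prime_orderOf hy', hy,
        gc' x y hx hy' hxp (by have := hp.ne_two; omega) hne hxy,
        h.reachable_of_commute (x := ⟨x, _⟩) (y := ⟨y, _⟩) hx hy' hne hxy⟩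
  have hg2 : g '' {x | orderOf x = 2} = g '' {x | (orderOf x).Prime ∧ orderOf x ≠ p} := by
    refine (Set.image_mono fun x (hx : orderOf x = 2) => ?_).antisymm ?_
    · have := hp.ne_two
      exact ⟨hx ▸ Nat.prime_two, by omega⟩
    · rintro _ ⟨x, ⟨hx, hxp⟩, rfl⟩
      obtain ⟨y, -, -, hy, e, -⟩ := hinv x hx hxp
      exact ⟨y, hy, e.symm⟩
  have hu : {x : Perm α | (orderOf x).Prime} =
      {x | p.Prime ∧ orderOf x = p} ∪ {x | (orderOf x).Prime ∧ orderOf x ≠ p} := by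
    ext x
    simp only [Set.mem_ofPred_eq, Set.mem_union]
    constructor
    · intro hx
      by_cases e : orderOf x = p
      · exact Or.inl ⟨e ▸ hx, e⟩
      · exact Or.inr ⟨hx, e⟩
    · rintro (⟨hx, e⟩ | hx)
      · rwa [e]
      · exact hx.1
  rw [hg2, ← image_union_image_ncard k g _ _ _ (fun x hx hx' => hx'.2 hx.2) hu]
  -- Values in a disjoint sum keep the elements of order `p` apart from all others.
  set f : Perm α → κ ⊕ ι := fun x => if x ∈ {x | p.Prime ∧ orderOf x = p} then Sum.inl (k x)
    else Sum.inr (g x) with hf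
  have f1 : ∀ x, (orderOf x).Prime → orderOf x = p → f x = Sum.inl (k x) :=
    fun x hx e => if_pos ⟨e ▸ hx, e⟩
  have f2 : ∀ x, orderOf x ≠ p → f x = Sum.inr (g x) := fun x e => if_neg fun e' => e e'.2
  refine h.numComponents_eq f ?_ ?_ ?_ ?_
  · intro x y hx hy e
    have eo := orderOf_eq_of_zpowers_eq e
    by_cases hxp : orderOf x = p
    · rw [f1 x hx hxp, f1 y hy (eo ▸ hxp), kz x y (hxp ▸ hx) hxp e]
    · rw [f2 x hxp, f2 y (eo ▸ hxp), gz x y hx hxp e]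
  · intro x y hx hy hne hc
    have hxp : orderOf x ≠ p := fun e => hnc x y hx hy hne e hc
    have hyp : orderOf y ≠ p := fun e => hnc y x hy hx hne.symm e hc.symm
    rw [f2 x hxp, f2 y hyp, gc' x y hx hy hxp hyp hne hc]
  · intro x y hx e
    have eo := h.orderOf_eq e
    by_cases hxp : orderOf (x : Perm α) = p
    · rw [f1 x hx hxp, f1 y (eo ▸ hx) (eo ▸ hxp), kπ x y (hxp ▸ hx) hxp e]
    · rw [f2 x hxp, f2 y (eo ▸ hxp), gπ x y hx hxp e]
  · intro x y hx hy e
    by_cases hxp : orderOf (x : Perm α) = p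
    · rw [f1 x hx hxp] at e
      by_cases hyp : orderOf (y : Perm α) = p
      · rw [f1 y hy hyp] at e
        exact kr x y (hxp ▸ hx) hxp hyp (Sum.inl_injective e)
      · rw [f2 y hyp] at e
        exact absurd e Sum.inl_ne_inr
    · rw [f2 x hxp] at e
      by_cases hyp : orderOf (y : Perm α) = p
      · rw [f1 y hy hyp] at e
        exact absurd e Sum.inr_ne_inl
      · rw [f2 y hyp] at e
        obtain ⟨x', _, hx', hx2, ex, rx⟩ := hinv x hx hxp
        obtain ⟨y', _, hy', hy2, ey, ry⟩ := hinv y hy hyp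
        have := gr ⟨x', hx'⟩ ⟨y', hy'⟩ hx2 hy2 (ex.symm.trans ((Sum.inr_injective e).trans ey))
        exact (rx.trans this).trans ry.symm

theorem c₀_perm_eq {p : ℕ} (hp : IsTopPrime (Fintype.card α) p) {ι : Type*} (g : Perm α → ι)
    (gz : ∀ x y, (orderOf x).Prime → orderOf x ≠ p →
      Subgroup.zpowers x = Subgroup.zpowers y → g x = g y)
    (gc : ∀ x y, (orderOf x).Prime → (orderOf y).Prime → orderOf x ≠ p → orderOf y ≠ p →
      orderOf x < orderOf y → Commute x y → g x = g y)
    (gr : ∀ x y, orderOf x = 2 → orderOf y = 2 → g x = g y → PowerConnected x y) :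
    c₀ (Perm α) = (Subgroup.zpowers '' {x : Perm α | p.Prime ∧ orderOf x = p}).ncard +
      (g '' {x | orderOf x = 2}).ncard := by
  have h := isPowerQuotient_id (Perm α)
  exact h.numComponents_perm_eq hp Subgroup.zpowers g (fun _ _ _ _ e => e)
    (fun _ _ _ _ e => congrArg (fun z : ({1}ᶜ : Set (Perm α)) => Subgroup.zpowers (z : Perm α)) e)
    (fun _ _ _ _ _ e => h.reachable_of_zpowers_eq e) gz gc
    (fun _ _ _ _ e => congrArg (fun z : ({1}ᶜ : Set (Perm α)) => g (z : Perm α)) e)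
    fun x y hx hy e => (gr x y hx hy e).2.2

theorem reachable_of_eq {V : Type*} {Y : SimpleGraph V} {v w : V} (h : v = w) : Y.Reachable v w :=
  h ▸ SimpleGraph.Reachable.refl v

theorem exists_orderOf_eq {p : ℕ} (hp : p.Prime) (hn : p ≤ Fintype.card α) :
    ∃ x : Perm α, orderOf x = p := by
  have := Fact.mk hp
  refine exists_prime_orderOf_dvd_card p ?_
  rw [Fintype.card_perm]
  exact Nat.dvd_factorial hp.pos hn

theorem ncard_image_const_unit {p : ℕ} (hpn : p ≤ Fintype.card α) [Decidable p.Prime] :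
    ((fun _ => () : Perm α → Unit) '' {x | p.Prime ∧ orderOf x = p}).ncard =
      if p.Prime then 1 else 0 := by
  split_ifs with h
  · obtain ⟨x, hx⟩ := exists_orderOf_eq h hpn
    rw [Set.Nonempty.image_const (s := {x : Perm α | p.Prime ∧ orderOf x = p}) ⟨x, h, hx⟩,
      Set.ncard_singleton]
  · rw [Set.ncard_eq_zero, Set.image_eq_empty, Set.eq_empty_iff_forall_notMem]
    exact fun x hx => h hx.1

theorem IsTopPrime.le {n p : ℕ} (hp : IsTopPrime n p) : p ≤ n := by
  have := hp.eq_or_eq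
  omega

theorem IsTopPrime.isConj {p : ℕ} (hp : IsTopPrime (Fintype.card α) p) (h : p.Prime)
    {x y : Perm α} (hx : orderOf x = p) (hy : orderOf y = p) : IsConj x y := by
  have hn : Fintype.card α < 2 * p := by
    have := hp.eq_or_eq
    have := hp.ne_two
    have := h.two_le
    omega
  rw [isConj_iff_cycleType_eq, (cycleType_eq_singleton_iff h hn x).2 hx,
    (cycleType_eq_singleton_iff h hn y).2 hy]

/-- Order and support size determine the type of an element of prime order, so the invariant is a
function `γ` of these two. For prime `p`, the elements of order `p` are conjugate and give one
vertex. -/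
theorem cType₀_perm_eq {p : ℕ} (hp : IsTopPrime (Fintype.card α) p) {ι : Type*} (γ : ℕ → ℕ → ι)
    (gc : ∀ x y : Perm α, (orderOf x).Prime → (orderOf y).Prime → orderOf x ≠ p → orderOf y ≠ p →
      orderOf x < orderOf y → Commute x y →
        γ (orderOf x) x.support.card = γ (orderOf y) y.support.card)
    (gr : ∀ x y : Perm α, orderOf x = 2 → orderOf y = 2 →
      γ 2 x.support.card = γ 2 y.support.card → IsConj x y ∨ PowerConnected x y) :
    cType₀ (⊤ : Subgroup (Perm α)) = (if p.Prime then 1 else 0) +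
      ((fun x : Perm α => γ 2 x.support.card) '' {x | orderOf x = 2}).ncard := by
  have h := isPowerQuotient_partition α
  rw [cType₀, h.numComponents_perm_eq hp (fun _ => ()) (fun x => γ (orderOf x) x.support.card),
    ncard_image_const_unit hp.le]
  · congr 2
    exact Set.image_congr fun x (hx : orderOf x = 2) => by rw [hx]
  · exact fun _ _ _ _ _ => rfl
  · exact fun _ _ _ _ _ => rfl
  · intro x y hpp hx hy _
    have e := partition_eq_of_isConj.1 (hp.isConj hpp hx hy)
    exact reachable_of_eq (Subtype.ext (Subtype.ext e))
  · intro x y _ _ e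
    rw [support_eq_of_zpowers_eq e, orderOf_eq_of_zpowers_eq e]
  · exact gc
  · intro x y _ _ e
    have e' := partition_eq_of_isConj.2 (congrArg (fun z => z.1.1) e)
    rw [h.orderOf_eq e, ← sum_cycleType, ← sum_cycleType, isConj_iff_cycleType_eq.1 e']
  · intro x y hx hy e
    rw [hx, hy] at e
    rcases gr x y hx hy e with e | e
    · exact reachable_of_eq (Subtype.ext (Subtype.ext (partition_eq_of_isConj.1 e)))
    · exact h.reachable_of_reachable e.2.2

theorem cOrder₀_perm_eq {p : ℕ} (hp : IsTopPrime (Fintype.card α) p) (hn : 2 ≤ Fintype.card α) :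
    cOrder₀ (Perm α) = (if p.Prime then 1 else 0) + 1 := by
  have h := isPowerQuotient_orderOf (Perm α)
  obtain ⟨t, ht⟩ := exists_orderOf_eq (α := α) Nat.prime_two hn
  rw [cOrder₀, h.numComponents_perm_eq hp (fun _ => ()) (fun _ => ()),
    ncard_image_const_unit hp.le, Set.Nonempty.image_const ⟨t, ht⟩, Set.ncard_singleton]
  · exact fun _ _ _ _ _ => rfl
  · exact fun _ _ _ _ _ => rfl
  · intro x y _ hx hy _
    exact reachable_of_eq (Subtype.ext (Subtype.ext (hx.trans hy.symm)))
  · exact fun _ _ _ _ _ => rfl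
  · exact fun _ _ _ _ _ _ _ _ => rfl
  · exact fun _ _ _ _ _ => rfl
  · intro x y hx hy _
    exact reachable_of_eq (Subtype.ext (Subtype.ext (hx.trans hy.symm)))

end PrimeOrder

/-! ### Top primes and involutions in explicit degrees. -/

section SymmetricGroups

open Equiv Equiv.Perm

/-- Uniqueness is parity: `n` and `n - 1` are not both odd. -/
theorem IsTopPrime.of_prime {n p : ℕ} (hp : p.Prime) (h2 : p ≠ 2) (hn : p = n ∨ p + 1 = n) :
    IsTopPrime n p where
  eq_or_eq := hn
  ne_two := h2
  eq_of_prime q hq hq2 hqn := by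
    have h1 := hp.eq_two_or_odd
    have h3 := hq.eq_two_or_odd
    omega

theorem orderOf_eq_two_iff {G : Type*} [Group G] {x : G} : orderOf x = 2 ↔ x ^ 2 = 1 ∧ x ≠ 1 := by
  have : Fact (Nat.Prime 2) := ⟨Nat.prime_two⟩
  exact orderOf_eq_prime_iff

theorem eq_of_zpowers_eq_of_orderOf_eq_two {G : Type*} [Group G] {x y : G} (hx : orderOf x = 2)
    (h : Subgroup.zpowers x = Subgroup.zpowers y) : x = y := by
  have hy : orderOf y = 2 := by rw [← orderOf_eq_of_zpowers_eq h, hx]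
  obtain ⟨k, hk⟩ := Subgroup.mem_zpowers_iff.1 (h ▸ Subgroup.mem_zpowers x)
  rw [← zpow_mod_orderOf, hy] at hk
  rcases Int.emod_two_eq_zero_or_one k with e | e
  · rw [Nat.cast_ofNat, e, zpow_zero] at hk
    rw [← hk, orderOf_one] at hx
    omega
  · rw [Nat.cast_ofNat, e, zpow_one] at hk
    exact hk.symm

theorem ncard_zpowers_image {α : Type*} [Fintype α] [DecidableEq α] {p N : ℕ} (hp : p.Prime)
    (hpn : p = Fintype.card α ∨ p + 1 = Fintype.card α)
    (hN : N * ((p - 1) * p) = (Fintype.card α).factorial) :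
    (Subgroup.zpowers '' {x : Perm α | p.Prime ∧ orderOf x = p}).ncard = N := by
  have h2 := hp.two_le
  simp only [hp, true_and]
  refine Nat.eq_of_mul_eq_mul_right (Nat.mul_pos (by omega) (by omega))
    ((card_zpowers_image_mul_eq_factorial hp hpn).trans hN.symm)

/-- If each element of order `3` commutes with at most one involution, then different involutions
lie in different components. -/
theorem c₀_perm_eq_add_card_involutions {α : Type*} [Fintype α] [DecidableEq α] {p : ℕ}
    (hp : IsTopPrime (Fintype.card α) p)
    (ho : ∀ x : Perm α, (orderOf x).Prime → orderOf x ≠ p → orderOf x = 2 ∨ orderOf x = 3)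
    (hu : p ≠ 3 → ∀ x x' y : Perm α, orderOf x = 2 → orderOf x' = 2 → orderOf y = 3 →
      Commute x y → Commute x' y → x = x') :
    c₀ (Perm α) = (Subgroup.zpowers '' {x : Perm α | p.Prime ∧ orderOf x = p}).ncard +
      (Finset.univ.filter fun x : Perm α => x ^ 2 = 1 ∧ x ≠ 1).card := by
  -- An involution goes to the singleton of itself, an element of order `3` to the set of
  -- involutions commuting with it, which by `hu` has at most one member if `p ≠ 3`.
  set g : Perm α → Set (Perm α) := fun x =>
    {y | orderOf y = 2 ∧ Commute y x ∧ (orderOf x = 2 → y = x)} with hg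
  have g2 : ∀ x, orderOf x = 2 → g x = {x} := by
    intro x hx
    ext y
    simp only [hg, Set.mem_ofPred_eq, Set.mem_singleton_iff]
    constructor
    · exact fun h => h.2.2 hx
    · rintro rfl
      exact ⟨hx, Commute.refl _, fun _ => rfl⟩
  have g3 : ∀ x y, orderOf x = 2 → orderOf y = 3 → 3 ≠ p → Commute x y → g y = {x} := by
    intro x y hx hy h3 hc
    ext z
    simp only [hg, Set.mem_ofPred_eq, Set.mem_singleton_iff]
    constructor
    · exact fun h => hu h3.symm z x y h.1 hx hy h.2.1 hc
    · rintro rfl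
      exact ⟨hx, hc, fun h => absurd h (by omega)⟩
  have hinj : Set.InjOn g {x | orderOf x = 2} := by
    intro x hx y hy e
    rw [g2 x hx, g2 y hy] at e
    exact Set.singleton_injective e
  rw [c₀_perm_eq hp g, hinj.ncard_image]
  · congr 1
    rw [← Set.ncard_coe_finset]
    congr 1
    ext x
    simp [orderOf_eq_two_iff]
  · intro x y hx hxp e
    rcases ho x hx hxp with h | h
    · rw [eq_of_zpowers_eq_of_orderOf_eq_two h e]
    · have hcomm : ∀ {u v z : Perm α}, Subgroup.zpowers u = Subgroup.zpowers v →
          Commute z u → Commute z v := by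
        intro u v z e hz
        obtain ⟨k, hk⟩ := Subgroup.mem_zpowers_iff.1 (e.symm ▸ Subgroup.mem_zpowers v)
        exact hk ▸ hz.zpow_right k
      ext z
      simp only [hg, Set.mem_ofPred_eq, ← orderOf_eq_of_zpowers_eq e, h]
      exact ⟨fun h' => ⟨h'.1, hcomm e h'.2.1, fun h => absurd h (by omega)⟩,
        fun h' => ⟨h'.1, hcomm e.symm h'.2.1, fun h => absurd h (by omega)⟩⟩
  · intro x y hx hy hxp hyp hlt hc
    have hx' := ho x hx hxp
    have hy' := ho y hy hyp
    have hx2 : orderOf x = 2 := by omega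
    have hy3 : orderOf y = 3 := by omega
    rw [g2 x hx2, g3 x y hx2 hy3 (by omega) hc]
  · intro x y hx hy e
    rw [hinj hx hy e]
    exact .refl (hy ▸ Nat.prime_two)

/-! ### Power graphs in degrees 2 to 7. -/

theorem prime_le_seven_cases {q n : ℕ} (hq : q.Prime) (h : q ≤ n) (hn : n ≤ 7) :
    q = 2 ∨ q = 3 ∨ q = 5 ∨ q = 7 := by
  have : q ≤ 7 := h.trans hn
  interval_cases q <;> revert hq <;> norm_num

/-- The prime `2` is never a top prime; the value `1` is not prime and makes the top class empty. -/
theorem isTopPrime_two_one : IsTopPrime 2 1 where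
  eq_or_eq := by omega
  ne_two := by omega
  eq_of_prime q hq hq2 hqn := by omega

theorem c₀_sym_two : c₀ (Sym 2) = 1 := by
  have h := c₀_perm_eq (α := Fin 2) (p := 1) (by simpa using isTopPrime_two_one) (fun _ => ())
    (fun _ _ _ _ _ => rfl) (fun _ _ _ _ _ _ _ _ => rfl) fun x y hx hy _ => ?_
  · obtain ⟨t, ht⟩ := exists_orderOf_eq (α := Fin 2) Nat.prime_two (by simp)
    rw [h, Set.Nonempty.image_const (s := {x : Perm (Fin 2) | orderOf x = 2}) ⟨t, ht⟩,
      Set.ncard_singleton]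
    simp [Nat.not_prime_one]
  · have : ∀ x y : Perm (Fin 2), x ≠ 1 → y ≠ 1 → x = y := by decide
    rw [orderOf_eq_two_iff] at hx
    obtain rfl := this x y hx.2 (orderOf_eq_two_iff.1 hy).2
    exact .refl (by rw [hy]; exact Nat.prime_two)

theorem isTopPrime_card {n p : ℕ} (hp : p.Prime) (h2 : p ≠ 2) (hn : p = n ∨ p + 1 = n) :
    IsTopPrime (Fintype.card (Fin n)) p := by
  rw [Fintype.card_fin]
  exact .of_prime hp h2 hn

theorem c₀_sym_three : c₀ (Sym 3) = 4 := by
  rw [c₀_perm_eq_add_card_involutions (isTopPrime_card Nat.prime_three (by omega) (by omega)),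
    ncard_zpowers_image (N := 1) Nat.prime_three (by simp) (by simp; rfl)]
  · decide
  · intro x hx h3
    have := prime_le_seven_cases hx (orderOf_le_card hx) (by simp)
    have := orderOf_le_card hx
    rw [Fintype.card_fin] at this
    omega
  · exact fun h => absurd rfl h

theorem c₀_sym_four : c₀ (Sym 4) = 13 := by
  rw [c₀_perm_eq_add_card_involutions (isTopPrime_card Nat.prime_three (by omega) (by omega)),
    ncard_zpowers_image (N := 4) Nat.prime_three (by simp) (by simp; rfl)]
  · decide +kernel
  · intro x hx h3
    have := prime_le_seven_cases hx (orderOf_le_card hx) (by simp)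
    have := orderOf_le_card hx
    rw [Fintype.card_fin] at this
    omega
  · exact fun h => absurd rfl h

theorem support_card_of_commute_fin_five {x y : Perm (Fin 5)} (hx : orderOf x = 2)
    (hy : orderOf y = 3) (h : Commute x y) : x.support.card = 2 ∧ y.support.card = 3 := by
  have hx' : (orderOf x).Prime := hx ▸ Nat.prime_two
  have hy' : (orderOf y).Prime := hy ▸ Nat.prime_three
  obtain ⟨a, b, c, d, h1, h2, h3, -⟩ := exists_card_orbits_of_commute hx' hy' (by omega) h
  have hxs := card_support_pos hx'
  have hys := card_support_pos hy'
  rw [Fintype.card_fin] at h1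
  rw [hx, hy] at h1 h2 h3
  omega

/-- The involution must transpose the two points fixed by the `3`-cycle `y`. Up to conjugation `y`
is `t`, and the involution is `swap 0 1`. -/
theorem eq_of_commute_of_orderOf_eq_three_fin_five {x x' y : Perm (Fin 5)} (hx : orderOf x = 2)
    (hx' : orderOf x' = 2) (hy : orderOf y = 3) (h : Commute x y) (h' : Commute x' y) : x = x' := by
  set t : Perm (Fin 5) := swap 2 3 * swap 2 4 with ht
  have hto : orderOf t = 3 := orderOf_three_cycle (by decide) (by decide) (by decide)
  have hts : t.support.card = 3 := by decide
  have key : ∀ x : Perm (Fin 5), x ^ 2 = 1 ∧ x ≠ 1 → x * t = t * x → x = swap 0 1 := by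
    decide +kernel
  obtain ⟨g, hg⟩ := isConj_iff.1 (isConj_of_orderOf_eq (x := y) (y := t) (hy ▸ Nat.prime_three)
    (hy.trans hto.symm) ((support_card_of_commute_fin_five hx hy h).2.trans hts.symm))
  have key' : ∀ x : Perm (Fin 5), orderOf x = 2 → Commute x y → x = g⁻¹ * swap 0 1 * g := by
    intro x hx h
    have e := key (g * x * g⁻¹) (orderOf_eq_two_iff.1 ?_) ?_
    · rw [← e]; group
    · rw [← hx]
      exact orderOf_injective (MulAut.conj g).toMonoidHom (MulAut.conj g).injective x
    · rw [← hg]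
      simp only [mul_assoc, inv_mul_cancel_left]
      rw [← mul_assoc x, h.eq, mul_assoc]
  rw [key' x hx h, key' x' hx' h']

theorem c₀_sym_five : c₀ (Sym 5) = 31 := by
  rw [c₀_perm_eq_add_card_involutions (isTopPrime_card Nat.prime_five (by omega) (by omega)),
    ncard_zpowers_image (N := 6) Nat.prime_five (by simp) (by simp; rfl)]
  · decide +kernel
  · intro x hx h3
    have := prime_le_seven_cases hx (orderOf_le_card hx) (by simp)
    have := orderOf_le_card hx
    rw [Fintype.card_fin] at this
    omega
  · exact fun _ x x' y hx hx' hy h h' => eq_of_commute_of_orderOf_eq_three_fin_five hx hx' hy h h'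

theorem two_dvd_card_support_of_orderOf_eq_two {α : Type*} [Fintype α] [DecidableEq α]
    {x : Perm α} (hx : orderOf x = 2) : 2 ∣ x.support.card :=
  two_dvd_card_support (orderOf_eq_two_iff.1 hx).1

theorem card_support_pos_of_orderOf_eq_two {α : Type*} [Fintype α] [DecidableEq α]
    {x : Perm α} (hx : orderOf x = 2) : 0 < x.support.card :=
  card_support_pos (by rw [hx]; exact Nat.prime_two)

/-- Six points allow only a transposition with a disjoint `3`-cycle, or one common orbit of size
`6`. -/
theorem card_support_of_commute_fin_six {x y : Perm (Fin 6)} (hx : (orderOf x).Prime)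
    (hy : (orderOf y).Prime) (hy5 : orderOf y ≠ 5)
    (hlt : orderOf x < orderOf y) (h : Commute x y) :
    orderOf x = 2 ∧ orderOf y = 3 ∧ x.support.card ≠ 4 ∧
      (x.support.card = 6 ↔ y.support.card = 6) := by
  obtain ⟨a, b, c, d, h1, h2, h3, -⟩ := exists_card_orbits_of_commute hx hy hlt.ne h
  have hxs := card_support_pos hx
  have hys := card_support_pos hy
  have hxc := prime_le_seven_cases hx (orderOf_le_card hx) (by simp)
  have hyc := prime_le_seven_cases hy (orderOf_le_card hy) (by simp)
  have hxl := orderOf_le_card hx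
  have hyl := orderOf_le_card hy
  rw [Fintype.card_fin] at h1 hxl hyl
  have ex : orderOf x = 2 := by omega
  have ey : orderOf y = 3 := by omega
  rw [ex, ey] at h1 h2 h3
  omega

/-- No element of order `3` commutes with a double transposition, so each of these `45` is a class
of its own. The other involutions form two classes, told apart by full support. With the `36`
subgroups of order `5`, the total is `36 + 45 + 2`. -/
theorem c₀_sym_six : c₀ (Sym 6) = 83 := by
  let g : Perm (Fin 6) → Bool ⊕ Perm (Fin 6) := fun x =>
    if orderOf x = 2 ∧ x.support.card = 4 then Sum.inr x else Sum.inl (decide (x.support.card = 6))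
  -- `g'` agrees with `g` on involutions and avoids `orderOf`, so its image can be computed.
  let g' : Perm (Fin 6) → Bool ⊕ Perm (Fin 6) := fun x =>
    if x.support.card = 4 then Sum.inr x else Sum.inl (decide (x.support.card = 6))
  have hg : g '' {x | orderOf x = 2} =
      ((Finset.univ.filter fun x : Perm (Fin 6) => x ^ 2 = 1 ∧ x ≠ 1).image g' : Finset _) := by
    rw [Finset.coe_image]
    have : {x : Perm (Fin 6) | orderOf x = 2} =
        ((Finset.univ.filter fun x : Perm (Fin 6) => x ^ 2 = 1 ∧ x ≠ 1 : Finset _) : Set _) := by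
      ext x
      simp [orderOf_eq_two_iff]
    rw [← this]
    exact Set.image_congr fun x (hx : orderOf x = 2) => by simp [g, g', hx]
  rw [c₀_perm_eq (isTopPrime_card Nat.prime_five (by omega) (by omega)) g,
    ncard_zpowers_image (N := 36) Nat.prime_five (by simp) (by simp; rfl), hg, Set.ncard_coe_finset]
  · have : ((Finset.univ.filter fun x : Perm (Fin 6) => x ^ 2 = 1 ∧ x ≠ 1).image g').card = 47 := by
      decide +kernel
    rw [this]
  · intro x y _ _ e
    by_cases h : orderOf x = 2
    · rw [eq_of_zpowers_eq_of_orderOf_eq_two h e]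
    · have h' : orderOf y ≠ 2 := orderOf_eq_of_zpowers_eq e ▸ h
      simp only [g, h, h', false_and, if_false, support_eq_of_zpowers_eq e]
  · intro x y hx hy hx5 hy5 hlt h
    obtain ⟨ex, ey, h4, h6⟩ := card_support_of_commute_fin_six hx hy hy5 hlt h
    simp [g, ex, ey, h4, h6]
  · intro x y hx hy e
    have hxd := two_dvd_card_support_of_orderOf_eq_two hx
    have hyd := two_dvd_card_support_of_orderOf_eq_two hy
    have hxs := Finset.card_le_univ x.support
    have hys := Finset.card_le_univ y.support
    rw [Fintype.card_fin] at hxs hys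
    simp only [g, hx, hy, true_and] at e
    split_ifs at e with h1 h2
    · rw [Sum.inr_injective e]
      exact .refl (by rw [hy]; exact Nat.prime_two)
    · have e := decide_eq_decide.1 (Sum.inl_injective e)
      by_cases h6 : x.support.card = 6
      · exact powerConnected_fin_six hx hy h6 (e.1 h6)
      · have h6' : y.support.card ≠ 6 := fun h => h6 (e.2 h)
        refine powerConnected_of_card_support_le (by simp) hx hy ?_ ?_ <;>
        · rw [Fintype.card_fin]
          omega

/-- In the orbit equation, a support of size `6` occurs only as one orbit of size `6` common to both
permutations. -/
theorem card_support_of_commute_fin_seven {x y : Perm (Fin 7)} (hx : (orderOf x).Prime)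
    (hy : (orderOf y).Prime) (hy7 : orderOf y ≠ 7)
    (hlt : orderOf x < orderOf y) (h : Commute x y) :
    (x.support.card = 6 ↔ y.support.card = 6) ∧
      (x.support.card = 6 → x.support = y.support) := by
  obtain ⟨a, b, c, d, h1, h2, h3, h4⟩ := exists_card_orbits_of_commute hx hy hlt.ne h
  have hxs := card_support_pos hx
  have hys := card_support_pos hy
  have hxc := prime_le_seven_cases hx (orderOf_le_card hx) (by simp)
  have hyc := prime_le_seven_cases hy (orderOf_le_card hy) (by simp)
  rw [Fintype.card_fin] at h1
  have key : (x.support.card = 6 ↔ y.support.card = 6) ∧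
      (x.support.card = 6 → (x.support ∩ y.support).card = 6) := by
    have ex : orderOf x = 2 ∨ orderOf x = 3 := by omega
    have ey : orderOf y = 3 ∨ orderOf y = 5 := by omega
    rcases ex with ex | ex <;> rcases ey with ey | ey <;> rw [ex, ey] at h1 h2 h3 h4 <;> omega
  refine ⟨key.1, fun h6 => ?_⟩
  have e1 := Finset.eq_of_subset_of_card_le (Finset.inter_subset_left (s₁ := x.support)
    (s₂ := y.support)) (by rw [key.2 h6, h6])
  have e2 := Finset.eq_of_subset_of_card_le (Finset.inter_subset_right (s₁ := x.support)
    (s₂ := y.support)) (by rw [key.2 h6, key.1.1 h6])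
  exact e1.symm.trans e2

/-- Involutions moving six points are sorted by their fixed point into `7` classes; all others share
the class marked `∅`. The subgroups of order `7` add `7! / (7 * 6) = 120`. -/
theorem c₀_sym_seven : c₀ (Sym 7) = 128 := by
  let g : Perm (Fin 7) → Finset (Fin 7) := fun x => if x.support.card = 6 then x.supportᶜ else ∅
  have hg : g '' {x | orderOf x = 2} =
      (insert ∅ (Finset.univ.image fun i : Fin 7 => ({i} : Finset (Fin 7))) : Finset _) := by
    ext s
    simp only [Set.mem_image, Set.mem_ofPred_eq, Finset.coe_insert, Finset.coe_image,
      Finset.coe_univ, Set.image_univ, Set.mem_insert_iff, Set.mem_range]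
    constructor
    · rintro ⟨x, -, rfl⟩
      by_cases h : x.support.card = 6
      · have : (x.supportᶜ).card = 1 := by rw [Finset.card_compl, h, Fintype.card_fin]
        obtain ⟨i, hi⟩ := Finset.card_eq_one.1 this
        exact Or.inr ⟨i, by simp only [g, if_pos h, hi]⟩
      · exact Or.inl (if_neg h)
    · rintro (rfl | ⟨i, rfl⟩)
      · exact ⟨swap 0 1, orderOf_swap (by decide), by simp only [g]; decide⟩
      -- Conjugation by `swap 0 i` moves the only fixed point from `0` to `i`.
      · have h : ∀ i : Fin 7, let x := swap 0 i * (swap 1 2 * swap 3 4 * swap 5 6) * swap 0 i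
            (x ^ 2 = 1 ∧ x ≠ 1) ∧ x.support.card = 6 ∧ x.supportᶜ = {i} := by
          decide +kernel
        obtain ⟨h1, h2, h3⟩ := h i
        exact ⟨_, orderOf_eq_two_iff.2 h1, by simp only [g]; rw [if_pos h2, h3]⟩
  rw [c₀_perm_eq (isTopPrime_card Nat.prime_seven (by omega) (by omega)) g,
    ncard_zpowers_image (N := 120) Nat.prime_seven (by simp) (by simp; rfl), hg,
    Set.ncard_coe_finset]
  · decide
  · intro x y _ _ e
    simp only [g, support_eq_of_zpowers_eq e]
  · intro x y hx hy hx7 hy7 hlt h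
    obtain ⟨h6, hs⟩ := card_support_of_commute_fin_seven hx hy hy7 hlt h
    by_cases h' : x.support.card = 6
    · simp only [g, hs h']
    · simp only [g, if_neg h', if_neg fun h => h' (h6.2 h)]
  · intro x y hx hy e
    have hxd := two_dvd_card_support_of_orderOf_eq_two hx
    have hyd := two_dvd_card_support_of_orderOf_eq_two hy
    have hxs := Finset.card_le_univ x.support
    have hys := Finset.card_le_univ y.support
    rw [Fintype.card_fin] at hxs hys
    have hne : ∀ z : Perm (Fin 7), z.support.card = 6 → z.supportᶜ ≠ ∅ := by
      intro z hz h
      have := congrArg Finset.card h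
      rw [Finset.card_compl, hz, Fintype.card_fin, Finset.card_empty] at this
      omega
    simp only [g] at e
    split_ifs at e with h1 h2 h2
    · exact powerConnected_of_support_eq hx hy h1 (compl_injective e)
    · exact absurd e (hne x h1)
    · exact absurd e.symm (hne y h2)
    · refine powerConnected_of_card_support_le (by simp) hx hy ?_ ?_ <;>
      · rw [Fintype.card_fin]
        omega

theorem c₀_perm_of_eight_le_card {α : Type*} [Fintype α] [DecidableEq α]
    (hα : 8 ≤ Fintype.card α) {p : ℕ} (hp : IsTopPrime (Fintype.card α) p) :
    c₀ (Perm α) = (Subgroup.zpowers '' {x : Perm α | p.Prime ∧ orderOf x = p}).ncard + 1 := by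
  obtain ⟨t, ht⟩ := exists_orderOf_eq (α := α) Nat.prime_two (by omega)
  rw [c₀_perm_eq hp (fun _ => ()) (fun _ _ _ _ _ => rfl) (fun _ _ _ _ _ _ _ _ => rfl)
    fun x y hx hy _ => powerConnected_of_eight_le_card hα hx hy,
    Set.Nonempty.image_const (s := {x : Perm α | orderOf x = 2}) ⟨t, ht⟩, Set.ncard_singleton]

/-- This covers two opposite situations: degrees `2` and `3`, where all involutions are conjugate,
and degrees from `8` on, where all are power connected. -/
theorem cType₀_perm_of_forall {α : Type*} [Fintype α] [DecidableEq α]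
    (hα : 2 ≤ Fintype.card α) {p : ℕ} (hp : IsTopPrime (Fintype.card α) p)
    (h : ∀ x y : Perm α, orderOf x = 2 → orderOf y = 2 → IsConj x y ∨ PowerConnected x y) :
    cType₀ (⊤ : Subgroup (Perm α)) = (if p.Prime then 1 else 0) + 1 := by
  obtain ⟨t, ht⟩ := exists_orderOf_eq (α := α) Nat.prime_two hα
  rw [cType₀_perm_eq hp (fun _ _ => ()) (fun _ _ _ _ _ _ _ _ => rfl)
    fun x y hx hy _ => h x y hx hy,
    Set.Nonempty.image_const (s := {x : Perm α | orderOf x = 2}) ⟨t, ht⟩, Set.ncard_singleton]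

/-! ### Type graphs in degrees 2 to 7. -/

theorem card_support_of_orderOf_eq_two {n : ℕ} {x : Perm (Fin n)} (hx : orderOf x = 2) :
    2 ∣ x.support.card ∧ 0 < x.support.card ∧ x.support.card ≤ n := by
  have h := Finset.card_le_univ x.support
  rw [Fintype.card_fin] at h
  exact ⟨two_dvd_card_support_of_orderOf_eq_two hx, card_support_pos_of_orderOf_eq_two hx, h⟩

theorem isConj_of_orderOf_eq_two {α : Type*} [Fintype α] [DecidableEq α] {x y : Perm α}
    (hx : orderOf x = 2) (hy : orderOf y = 2) (h : x.support.card = y.support.card) :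
    IsConj x y :=
  isConj_of_orderOf_eq (by rw [hx]; exact Nat.prime_two) (hx.trans hy.symm) h

theorem cType₀_sym_two : cType₀ (⊤ : Subgroup (Sym 2)) = 1 := by
  rw [cType₀_perm_of_forall (by simp) (p := 1) (by simpa using isTopPrime_two_one),
    if_neg Nat.not_prime_one]
  intro x y hx hy
  have h1 := card_support_of_orderOf_eq_two hx
  have h2 := card_support_of_orderOf_eq_two hy
  exact Or.inl (isConj_of_orderOf_eq_two hx hy (by omega))

theorem cType₀_sym_three : cType₀ (⊤ : Subgroup (Sym 3)) = 2 := by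
  rw [cType₀_perm_of_forall (by simp) (isTopPrime_card Nat.prime_three (by omega) (by omega)),
    if_pos Nat.prime_three]
  intro x y hx hy
  have h1 := card_support_of_orderOf_eq_two hx
  have h2 := card_support_of_orderOf_eq_two hy
  exact Or.inl (isConj_of_orderOf_eq_two hx hy (by omega))

theorem ncard_image_support_card {n : ℕ} {ι : Type*} [DecidableEq ι] (γ : ℕ → ι) (s : Finset ι)
    (h1 : ∀ x : Perm (Fin n), orderOf x = 2 → γ x.support.card ∈ s)
    (h2 : ∀ i ∈ s, ∃ x : Perm (Fin n), (x ^ 2 = 1 ∧ x ≠ 1) ∧ γ x.support.card = i) :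
    ((fun x : Perm (Fin n) => γ x.support.card) '' {x | orderOf x = 2}).ncard = s.card := by
  rw [← Set.ncard_coe_finset]
  congr 1
  ext i
  constructor
  · rintro ⟨x, hx, rfl⟩
    exact h1 x hx
  · intro hi
    obtain ⟨x, hx, e⟩ := h2 i hi
    exact ⟨x, orderOf_eq_two_iff.2 hx, e⟩

/-- Besides the top prime `3` only the prime `2` occurs, so nothing links the two types of
involutions. -/
theorem cType₀_sym_four : cType₀ (⊤ : Subgroup (Sym 4)) = 3 := by
  rw [cType₀_perm_eq (isTopPrime_card Nat.prime_three (by omega) (by omega)) (fun _ k => k),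
    if_pos Nat.prime_three, ncard_image_support_card (fun k => k) {2, 4}]
  · rfl
  · intro x hx
    have h1 := card_support_of_orderOf_eq_two hx
    simp only [Finset.mem_insert, Finset.mem_singleton]
    omega
  · intro i hi
    simp only [Finset.mem_insert, Finset.mem_singleton] at hi
    rcases hi with rfl | rfl
    · exact ⟨swap 0 1, by decide⟩
    · exact ⟨swap 0 1 * swap 2 3, by decide⟩
  · intro x y hx hy hx3 hy3 hlt _
    have h1 := prime_le_seven_cases hx (orderOf_le_card hx) (by simp)
    have h2 := prime_le_seven_cases hy (orderOf_le_card hy) (by simp)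
    have h3 := orderOf_le_card hy
    rw [Fintype.card_fin] at h3
    omega
  · intro x y hx hy e
    exact Or.inl (isConj_of_orderOf_eq_two hx hy e)

theorem cType₀_sym_five : cType₀ (⊤ : Subgroup (Sym 5)) = 3 := by
  rw [cType₀_perm_eq (isTopPrime_card Nat.prime_five (by omega) (by omega))
    (fun _ k => decide (k = 4)), if_pos Nat.prime_five,
    ncard_image_support_card (fun k => decide (k = 4)) Finset.univ]
  · rfl
  · exact fun _ _ => Finset.mem_univ _
  · intro i _
    cases i
    · exact ⟨swap 0 1, by decide⟩
    · exact ⟨swap 0 1 * swap 2 3, by decide⟩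
  · intro x y hx hy hx5 hy5 hlt h
    have h1 := prime_le_seven_cases hx (orderOf_le_card hx) (by simp)
    have h2 := prime_le_seven_cases hy (orderOf_le_card hy) (by simp)
    have h3 := orderOf_le_card hy
    rw [Fintype.card_fin] at h3
    have := support_card_of_commute_fin_five (by omega) (by omega) h
    rw [this.1, this.2]
    rfl
  · intro x y hx hy e
    have h1 := card_support_of_orderOf_eq_two hx
    have h2 := card_support_of_orderOf_eq_two hy
    have e := decide_eq_decide.1 e
    exact Or.inl (isConj_of_orderOf_eq_two hx hy (by omega))

/-- The value `0` marks double transpositions, `1` the elements of full support, and `2` the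
transpositions and `3`-cycles. -/
theorem cType₀_sym_six : cType₀ (⊤ : Subgroup (Sym 6)) = 4 := by
  rw [cType₀_perm_eq (isTopPrime_card Nat.prime_five (by omega) (by omega))
    (fun q k => if q = 2 ∧ k = 4 then (0 : ℕ) else if k = 6 then 1 else 2), if_pos Nat.prime_five,
    ncard_image_support_card (fun k => if 2 = 2 ∧ k = 4 then (0 : ℕ) else if k = 6 then 1 else 2)
      {0, 1, 2}]
  · rfl
  · intro x _
    simp only [Finset.mem_insert, Finset.mem_singleton]
    split_ifs <;> omega
  · intro i hi
    simp only [Finset.mem_insert, Finset.mem_singleton] at hi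
    rcases hi with rfl | rfl | rfl
    · exact ⟨swap 0 1 * swap 2 3, by decide⟩
    · exact ⟨swap 0 1 * swap 2 3 * swap 4 5, by decide⟩
    · exact ⟨swap 0 1, by decide⟩
  · intro x y hx hy hx5 hy5 hlt h
    obtain ⟨ex, ey, h4, h6⟩ := card_support_of_commute_fin_six hx hy hy5 hlt h
    simp [ex, ey, h4, h6]
  · intro x y hx hy e
    have h1 := card_support_of_orderOf_eq_two hx
    have h2 := card_support_of_orderOf_eq_two hy
    refine Or.inl (isConj_of_orderOf_eq_two hx hy ?_)
    split_ifs at e <;> omega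

theorem cType₀_sym_seven : cType₀ (⊤ : Subgroup (Sym 7)) = 3 := by
  rw [cType₀_perm_eq (isTopPrime_card Nat.prime_seven (by omega) (by omega))
    (fun _ k => decide (k = 6)), if_pos Nat.prime_seven,
    ncard_image_support_card (fun k => decide (k = 6)) Finset.univ]
  · rfl
  · exact fun _ _ => Finset.mem_univ _
  · intro i _
    cases i
    · exact ⟨swap 0 1, by decide⟩
    · exact ⟨swap 0 1 * swap 2 3 * swap 4 5, by decide⟩
  · intro x y hx hy hx7 hy7 hlt h
    exact decide_eq_decide.2 (card_support_of_commute_fin_seven hx hy hy7 hlt h).1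
  · intro x y hx hy e
    have h1 := card_support_of_orderOf_eq_two hx
    have h2 := card_support_of_orderOf_eq_two hy
    have e := decide_eq_decide.1 e
    by_cases h6 : x.support.card = 6
    · exact Or.inl (isConj_of_orderOf_eq_two hx hy (h6.trans (e.1 h6).symm))
    · have h6' : y.support.card ≠ 6 := fun h => h6 (e.2 h)
      refine Or.inr (powerConnected_of_card_support_le (by simp) hx hy ?_ ?_) <;>
      · rw [Fintype.card_fin]
        omega

/-! ### Degrees from 8 on, and the order graphs. -/

theorem components_sym_of_top_prime {n p : ℕ} (hn : 8 ≤ n) (hp : p.Prime)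
    (hpn : p = n ∨ p + 1 = n) {N : ℕ} (hN : N * ((p - 1) * p) = n.factorial) :
    c₀ (Sym n) = N + 1 ∧ cType₀ (⊤ : Subgroup (Sym n)) = 2 ∧ cOrder₀ (Sym n) = 2 := by
  have hα : 8 ≤ Fintype.card (Fin n) := by rwa [Fintype.card_fin]
  have h := isTopPrime_card hp (by omega) hpn
  refine ⟨?_, ?_, ?_⟩
  · rw [c₀_perm_of_eight_le_card hα h, ncard_zpowers_image (N := N) hp (by simpa using hpn)
      (by simpa using hN)]
  · rw [cType₀_perm_of_forall (by omega) h fun x y hx hy =>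
      Or.inr (powerConnected_of_eight_le_card hα hx hy), if_pos hp]
  · rw [cOrder₀_perm_eq h (by omega), if_pos hp]

theorem components_sym_of_not_prime {n : ℕ} (hn : 8 ≤ n) (h1 : ¬ n.Prime)
    (h2 : ¬ (n - 1).Prime) :
    c₀ (Sym n) = 1 ∧ cType₀ (⊤ : Subgroup (Sym n)) = 1 ∧ cOrder₀ (Sym n) = 1 := by
  have hα : 8 ≤ Fintype.card (Fin n) := by rwa [Fintype.card_fin]
  have h : IsTopPrime (Fintype.card (Fin n)) n := by
    rw [Fintype.card_fin]
    refine ⟨Or.inl rfl, by omega, fun q hq _ hqn => ?_⟩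
    rcases hqn with rfl | rfl
    · rfl
    · exact absurd hq h2
  refine ⟨?_, ?_, ?_⟩
  · rw [c₀_perm_of_eight_le_card hα h]
    simp [h1]
  · rw [cType₀_perm_of_forall (by omega) h fun x y hx hy =>
      Or.inr (powerConnected_of_eight_le_card hα hx hy), if_neg h1]
  · rw [cOrder₀_perm_eq h (by omega), if_neg h1]

theorem cOrder₀_sym_two : cOrder₀ (Sym 2) = 1 := by
  rw [cOrder₀_perm_eq (p := 1) (by simpa using isTopPrime_two_one) (by simp),
    if_neg Nat.not_prime_one]

theorem cOrder₀_sym_of_top_prime {n p : ℕ} (hp : p.Prime) (h2 : p ≠ 2)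
    (hpn : p = n ∨ p + 1 = n) : cOrder₀ (Sym n) = 2 := by
  have := hp.two_le
  rw [cOrder₀_perm_eq (isTopPrime_card hp h2 hpn) (by rw [Fintype.card_fin]; omega), if_pos hp]

end SymmetricGroups

end PowerGraph

/-- The numbers of components of the proper power graph, of its quotient, of the proper power type
graph and of the proper order graph of the symmetric groups. -/
theorem theoremB :
    (∀ n : ℕ, 2 ≤ n → PowerGraph.c₀ (PowerGraph.Sym n) = PowerGraph.cTilde₀ (PowerGraph.Sym n)) ∧
    (PowerGraph.c₀ (PowerGraph.Sym 2) = 1 ∧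
      PowerGraph.c₀ (PowerGraph.Sym 3) = 4 ∧
      PowerGraph.c₀ (PowerGraph.Sym 4) = 13 ∧
      PowerGraph.c₀ (PowerGraph.Sym 5) = 31 ∧
      PowerGraph.c₀ (PowerGraph.Sym 6) = 83 ∧
      PowerGraph.c₀ (PowerGraph.Sym 7) = 128) ∧
    (PowerGraph.cType₀ (⊤ : Subgroup (PowerGraph.Sym 2)) = 1 ∧
      PowerGraph.cType₀ (⊤ : Subgroup (PowerGraph.Sym 3)) = 2 ∧
      PowerGraph.cType₀ (⊤ : Subgroup (PowerGraph.Sym 4)) = 3 ∧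
      PowerGraph.cType₀ (⊤ : Subgroup (PowerGraph.Sym 5)) = 3 ∧
      PowerGraph.cType₀ (⊤ : Subgroup (PowerGraph.Sym 6)) = 4 ∧
      PowerGraph.cType₀ (⊤ : Subgroup (PowerGraph.Sym 7)) = 3) ∧
    (PowerGraph.cOrder₀ (PowerGraph.Sym 2) = 1 ∧
      PowerGraph.cOrder₀ (PowerGraph.Sym 3) = 2 ∧
      PowerGraph.cOrder₀ (PowerGraph.Sym 4) = 2 ∧
      PowerGraph.cOrder₀ (PowerGraph.Sym 5) = 2 ∧
      PowerGraph.cOrder₀ (PowerGraph.Sym 6) = 2 ∧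
      PowerGraph.cOrder₀ (PowerGraph.Sym 7) = 2) ∧
    (∀ n : ℕ, 8 ≤ n →
      (n.Prime →
        PowerGraph.c₀ (PowerGraph.Sym n) = Nat.factorial (n - 2) + 1 ∧
        PowerGraph.cType₀ (⊤ : Subgroup (PowerGraph.Sym n)) = 2 ∧
        PowerGraph.cOrder₀ (PowerGraph.Sym n) = 2) ∧
      ((n - 1).Prime →
        PowerGraph.c₀ (PowerGraph.Sym n) = n * Nat.factorial (n - 3) + 1 ∧
        PowerGraph.cType₀ (⊤ : Subgroup (PowerGraph.Sym n)) = 2 ∧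
        PowerGraph.cOrder₀ (PowerGraph.Sym n) = 2) ∧
      (¬ n.Prime → ¬ (n - 1).Prime →
        PowerGraph.c₀ (PowerGraph.Sym n) = 1 ∧
        PowerGraph.cType₀ (⊤ : Subgroup (PowerGraph.Sym n)) = 1 ∧
        PowerGraph.cOrder₀ (PowerGraph.Sym n) = 1)) := by
  open PowerGraph in
  refine ⟨fun n _ => c₀_eq_cTilde₀ (Sym n),
    ⟨c₀_sym_two, c₀_sym_three, c₀_sym_four, c₀_sym_five, c₀_sym_six, c₀_sym_seven⟩,
    ⟨cType₀_sym_two, cType₀_sym_three, cType₀_sym_four, cType₀_sym_five, cType₀_sym_six,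
      cType₀_sym_seven⟩,
    ⟨cOrder₀_sym_two, cOrder₀_sym_of_top_prime Nat.prime_three (by omega) (by omega),
      cOrder₀_sym_of_top_prime Nat.prime_three (by omega) (by omega),
      cOrder₀_sym_of_top_prime Nat.prime_five (by omega) (by omega),
      cOrder₀_sym_of_top_prime Nat.prime_five (by omega) (by omega),
      cOrder₀_sym_of_top_prime Nat.prime_seven (by omega) (by omega)⟩,
    fun n hn => ⟨fun hp => components_sym_of_top_prime hn hp (Or.inl rfl) ?_,
      fun hp => components_sym_of_top_prime hn hp (Or.inr (by omega)) ?_,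
      fun h1 h2 => components_sym_of_not_prime hn h1 h2⟩⟩
  -- The quotient `n! / ((p - 1) * p)` is `(n - 2)!` for `p = n`, and `n * (n - 3)!` for `p = n -
  -- 1`.
  · obtain ⟨m, rfl⟩ : ∃ m, n = m + 2 := ⟨n - 2, by omega⟩
    simp only [Nat.add_sub_cancel, Nat.add_succ_sub_one, Nat.factorial_succ]
    ring
  · obtain ⟨m, rfl⟩ : ∃ m, n = m + 3 := ⟨n - 3, by omega⟩
    simp only [Nat.add_sub_cancel, Nat.add_succ_sub_one, Nat.factorial_succ]
    ring
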